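/- Let $k$ be a number field, $v$ a place of $k$ (archimedean or not), $k_v$ the completion of $k$ at $v$, and $\mathbb{C}_v$ the completion of an algebraic closure of $k_v$. Let $|\cdot|_v$ be the normalized absolute value on $k_v$, given by the modulus of additive Haar measure (so $|x|_v=|x|^{[k_v:\mathbb{R}]}$ if $v$ is archimedean and $|x|_v=q_v^{-\mathrm{ord}_v(x)}$, with $q_v$ the order of the residue field, otherwise), extended to $\mathbb{C}_v$. Let $\mathrm{vol}_v$ be Haar measure on $k_v$: Lebesgue measure if $k_v\cong\mathbb{R}$ or $\mathbb{C}$, and normalized by $\mathrm{vol}_v(\mathcal{O}_v)=1$ if $v$ is nonarchimedean. Let $E_v\subset\mathbb{C}_v^2$ be a nonempty bounded set that is stable under the group $\mathrm{Gal}^c(\mathbb{C}_v/k_v)$ of continuous automorphisms of $\mathbb{C}_v$ over $k_v$ (acting coordinatewise). For $n\ge 2$ put $$d^0_n(E_v)=\sup_{z_1,\dots,z_n\in E_v}\Bigl(\prod_{i\ne j}|z_i\wedge z_j|_v\Bigr)^{\frac1{n(n-1)}},\qquad (z_0,z_1)\wedge(w_0,w_1)=z_0w_1-z_1w_0 ,$$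 and let $d^0_\infty(E_v)=\lim_{n\to\infty}d^0_n(E_v)$ be the homogeneous transfinite diameter. For $n\ge 0$ let $\Gamma^0_v(n)$ be the space of homogeneous polynomials of degree $n$ in $k_v[x,y]$, with the measure $\mathrm{vol}_v$ transported from $k_v^{n+1}$ by the basis of monomials, let $$\mathcal{F}^0_v(n)=\Bigl\{f\in\Gamma^0_v(n):\ \sup_{z\in E_v}|f(z)|_v\le 1\Bigr\},$$ and let the local homogeneous sectional capacity $S^0_\gamma(E_v,H)\in[0,\infty]$ be defined by $$-\log S^0_\gamma(E_v,H)=\lim_{n\to\infty}\frac{2!}{n^2}\log \mathrm{vol}_v(\mathcal{F}^0_v(n)),$$ with $\log\infty=\infty$ and $-\log 0=\infty$. Then both limits exist (the second one in $[-\infty,\infty]$), $d^0_\infty(E_v)$ is finite, and $$S^0_\gamma(E_v,H)=d^0_\infty(E_v).$$ -/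

import Mathlib

open Filter Topology MeasureTheory NumberField IsDedekindDomain
open scoped ENNReal

namespace HomCap

noncomputable section

/-! ### Homogeneous transfinite diameter and homogeneous sectional capacity

Here `K` is a field, `C` is a field extension of `K`, `abv : C → ℝ` is a (normalized) absolute
value on `C`, and `vol` is a measure on `K`. -/

section General

variable {C : Type*} [Field C]

/-- `z ∧ w = z₀ w₁ - z₁ w₀`. -/
def wedge (z w : C × C) : C := z.1 * w.2 - z.2 * w.1

/-- `d⁰ₙ(E)`, the supremum over `z₁, …, zₙ ∈ E` of `(∏_{i ≠ j} |zᵢ ∧ zⱼ|) ^ (1 / (n (n - 1)))`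
(meaningful for `n ≥ 2`). -/
def homDiameter (abv : C → ℝ) (E : Set (C × C)) (n : ℕ) : ℝ≥0∞ :=
  ⨆ z : Fin n → E,
    (∏ p : Fin n × Fin n with p.1 ≠ p.2,
      ENNReal.ofReal (abv (wedge (z p.1 : C × C) (z p.2 : C × C)))) ^
        (1 / ((n : ℝ) * ((n : ℝ) - 1)))

/-- The homogeneous transfinite diameter `d⁰_∞(E) = lim_n d⁰ₙ(E)`. -/
def homTransfiniteDiameter (abv : C → ℝ) (E : Set (C × C)) : ℝ≥0∞ :=
  limUnder atTop (homDiameter abv E)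

/-- The sup norm `‖f‖_E` of a polynomial in two variables over `K` on a subset of `C²`. -/
def supNorm {K : Type*} [Field K] [Algebra K C] (abv : C → ℝ) (E : Set (C × C))
    (f : MvPolynomial (Fin 2) K) : ℝ≥0∞ :=
  ⨆ z ∈ E, ENNReal.ofReal (abv (MvPolynomial.aeval ![z.1, z.2] f))

variable (K : Type*) [Field K] [Algebra K C]

/-- `𝓕⁰(n)`: the forms of degree `n` in `K[x, y]` with sup norm at most `1` on `E`. -/
def unitForms (abv : C → ℝ) (E : Set (C × C)) (n : ℕ) : Set (MvPolynomial (Fin 2) K) :=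
  {f | f.IsHomogeneous n ∧ supNorm abv E f ≤ 1}

variable {K}

/-- The binary form `∑ aᵢ x^(n-i) y^i` of degree `n` with coefficient vector `a`. -/
def binaryForm (n : ℕ) (a : Fin (n + 1) → K) : MvPolynomial (Fin 2) K :=
  ∑ i : Fin (n + 1),
    MvPolynomial.C (a i) * MvPolynomial.X 0 ^ (n - (i : ℕ)) * MvPolynomial.X 1 ^ (i : ℕ)

/-- The volume of a set of forms of degree `n`, in the coordinates given by the basis
of monomials. -/
def formVolume [MeasurableSpace K] (vol : Measure K) (n : ℕ)
    (F : Set (MvPolynomial (Fin 2) K)) : ℝ≥0∞ :=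
  Measure.pi (fun _ : Fin (n + 1) => vol) (binaryForm n ⁻¹' F)

/-- `(2! / n²) log vol(𝓕⁰(n))`, with the value `⊤` if the volume is infinite. -/
def logVolume [MeasurableSpace K] (vol : Measure K) (abv : C → ℝ) (E : Set (C × C)) (n : ℕ) :
    EReal :=
  ((2 / (n : ℝ) ^ 2 : ℝ) : EReal) * ENNReal.log (formVolume vol n (unitForms K abv E n))

/-- The homogeneous sectional capacity `S⁰_γ(E, H)`, given by
`- log S⁰_γ(E, H) = lim_n (2! / n²) log vol(𝓕⁰(n))`. -/
def homSectionalCapacity [MeasurableSpace K] (vol : Measure K) (abv : C → ℝ)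
    (E : Set (C × C)) : ℝ≥0∞ :=
  EReal.exp (-limUnder atTop (logVolume vol abv E))

end General

/-- `E ⊆ C²` is stable under the group of continuous automorphisms of `C` over `K`. -/
def GaloisStable (K : Type*) {C : Type*} [Field K] [Field C] [Algebra K C] [TopologicalSpace C]
    (E : Set (C × C)) : Prop :=
  ∀ σ : C ≃A[K] C, ∀ z ∈ E, (σ z.1, σ z.2) ∈ E

/-! ### Archimedean places

For an archimedean place `w`, the field `ℂ` is an algebraic closure of `k_w = w.Completion`,
which embeds isometrically in `ℂ`, and it is complete; so `ℂ_w = ℂ`. -/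

section Archimedean

variable {k : Type*} [Field k] (w : InfinitePlace k)

instance archAlgebra : Algebra w.Completion ℂ :=
  (InfinitePlace.Completion.extensionEmbedding w).toAlgebra

instance archMeasurableSpace : MeasurableSpace w.Completion := borel _

instance archBorelSpace : BorelSpace w.Completion := ⟨rfl⟩

/-- The normalized absolute value `|z|_w = |z| ^ [k_w : ℝ]` on `ℂ_w = ℂ`. -/
def archAbs (z : ℂ) : ℝ := ‖z‖ ^ w.mult

/-- Lebesgue measure on `k_w ≅ ℝ` or `k_w ≅ ℂ`. -/
def archVol : Measure w.Completion :=
  open Classical in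
  if h : w.IsReal then
    Measure.map (InfinitePlace.Completion.isometryEquivRealOfIsReal h).symm volume
  else
    Measure.map (InfinitePlace.Completion.isometryEquivComplexOfIsComplex
      (InfinitePlace.not_isReal_iff_isComplex.mp h)).symm volume

end Archimedean

/-! ### Nonarchimedean places

Mathlib's norm on `k_v = v.adicCompletion k` is the normalized one, `‖x‖ = q_v ^ (-ord_v x)`. -/

section Nonarchimedean

variable {k : Type*} [Field k] [NumberField k] (v : HeightOneSpectrum (𝓞 k))

instance adicNontriviallyNormedField : NontriviallyNormedField (v.adicCompletion k) where
  non_trivial := (Valued.toNontriviallyNormedField (v.adicCompletion k) _).non_trivial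

instance adicUltrametric : IsUltrametricDist (v.adicCompletion k) :=
  inferInstanceAs (@IsUltrametricDist _ (Valued.toNormedField (v.adicCompletion k) _).toDist)

open scoped Valued in
theorem adic_finite_residueField : Finite 𝓀[v.adicCompletion k] := by
  have : Finite (𝓞 k ⧸ v.asIdeal) := v.asIdeal.finiteQuotientOfFreeOfNeBot v.ne_bot
  let f : 𝓞 k →+* 𝓀[v.adicCompletion k] :=
    (IsLocalRing.residue 𝒪[v.adicCompletion k]).comp
      (algebraMap (𝓞 k) (v.adicCompletionIntegers k))
  have hlt : ∀ x : 𝒪[v.adicCompletion k],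
      Valued.v (x : v.adicCompletion k) < 1 → IsLocalRing.residue 𝒪[v.adicCompletion k] x = 0 := by
    intro x hx
    rw [IsLocalRing.residue_eq_zero_iff]
    exact (Valuation.mem_maximalIdeal_iff _ _).2 hx
  have hker : ∀ r ∈ v.asIdeal, f r = 0 := fun r hr =>
    hlt _ (((v.valuedAdicCompletion_eq_valuation (K := k) r).trans_lt
      ((v.valuation_lt_one_iff_mem (K := k) r).2 hr)))
  have hsurj : Function.Surjective f := by
    intro y
    obtain ⟨x, rfl⟩ := IsLocalRing.residue_surjective y
    obtain ⟨c, hc⟩ := (v.denseRange_algebraMap k).exists_mem_open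
      (Metric.isOpen_ball (x := (x : v.adicCompletion k)) (ε := 1)) ⟨x, by simp⟩
    have hc' : Valued.v (algebraMap k (v.adicCompletion k) c - x) < 1 :=
      Valued.toNormedField.norm_lt_one_iff.1 (by simpa [dist_eq_norm] using hc)
    have hc1 : v.valuation k c ≤ 1 := by
      rw [← v.valuedAdicCompletion_eq_valuation' (K := k) c]
      have := Valued.v.map_add (algebraMap k (v.adicCompletion k) c - x) x
      rw [sub_add_cancel] at this
      exact this.trans (max_le hc'.le x.2)
    obtain ⟨r, hr⟩ := v.exists_valuation_sub_lt_of_integer (K := k) hc1 1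
    refine ⟨r, ?_⟩
    rw [← sub_eq_zero]
    change IsLocalRing.residue 𝒪[v.adicCompletion k] _ - _ = 0
    rw [← map_sub]
    refine hlt _ ?_
    rw [Units.val_one, ← v.valuedAdicCompletion_eq_valuation' (K := k)] at hr
    have := Valued.v.map_add (algebraMap k (v.adicCompletion k) (algebraMap (𝓞 k) k r - c))
      (algebraMap k (v.adicCompletion k) c - x)
    rw [map_sub, sub_add_sub_cancel] at this
    refine this.trans_lt (max_lt ?_ hc')
    rw [← map_sub]
    exact hr
  exact Finite.of_surjective (Ideal.Quotient.lift v.asIdeal f hker)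
    (Ideal.Quotient.lift_surjective_of_surjective _ _ hsurj)

instance adicProperSpace : ProperSpace (v.adicCompletion k) :=
  Valued.integer.properSpace_iff_completeSpace_and_isDiscreteValuationRing_integer_and_finite_residueField.2
    ⟨inferInstance, inferInstanceAs (IsDiscreteValuationRing (v.adicCompletionIntegers k)),
      adic_finite_residueField v⟩

instance adicMeasurableSpace : MeasurableSpace (v.adicCompletion k) := borel _

instance adicBorelSpace : BorelSpace (v.adicCompletion k) := ⟨rfl⟩

/-- Haar measure on `k_v`, normalized so that the ring of integers has volume `1`. -/
def adicVol : Measure (v.adicCompletion k) :=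
  Measure.addHaarMeasure
    ⟨⟨Metric.closedBall 0 1, isCompact_closedBall 0 1⟩,
      ⟨0, Metric.ball_subset_interior_closedBall (Metric.mem_ball_self one_pos)⟩⟩

/-- A fixed algebraic closure of `k_v`. -/
abbrev AdicAlgCl : Type _ := AlgebraicClosure (v.adicCompletion k)

/-- The unique extension of the absolute value of `k_v` to its algebraic closure. -/
instance adicAlgClNormedField : NormedField (AdicAlgCl v) :=
  spectralNorm.normedField (v.adicCompletion k) (AdicAlgCl v)

instance adicAlgClNormedAlgebra : NormedAlgebra (v.adicCompletion k) (AdicAlgCl v) :=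
  spectralNorm.normedAlgebra _ _

/-- `ℂ_v`, the completion of the algebraic closure of `k_v`. -/
abbrev AdicComplex : Type _ := UniformSpace.Completion (AdicAlgCl v)

/-- The normalized absolute value on `ℂ_v`. -/
def adicAbs (z : AdicComplex v) : ℝ := ‖z‖

end Nonarchimedean

end

end HomCap

/-!
Encode a binary form of degree `n` by a polynomial `p` of degree at most `n`, and let
`chebyshev K E n l` be the infimum of `‖·‖_E` over the forms of degree `n` whose polynomial is
monic of degree `l` with coefficients in `K`.

Over `C`, the maximum over `E` of the determinant of the monomials at `n + 1` points, which is a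
product of wedges, equals `∏ l ≤ n, chebyshev C E n l` up to the factor `(n + 1)!`: expand along
the last row for one inequality, and replace the monomials by nearly extremal monic polynomials
for the other. So these products govern `d⁰_∞(E)`. Over `K`, fixing the coefficients one at a
time, Fubini shows that `vol (𝓕⁰(n))` is `(∏ l ≤ n, chebyshev K E n l) ^ (-δ)` up to a factor
`exp (O(n log n))`, which is invisible on the scale `n²`.

Since `E` is Galois stable, the product of the conjugates of a form defined over a finite
extension of `K` is a form over `K` whose normalised sup norm is no worse. Such forms of large
degree, together with `chebyshev K E (n + m) (l + j) ≤ chebyshev K E n l * chebyshev K E m j`,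
bound the product over `K` asymptotically by the product over `C` at a fixed degree. Hence both
limits exist and agree.
-/

namespace HomCap

noncomputable section

open scoped NNReal

theorem enorm_finsetProd {F ι : Type*} [NormedField F] (s : Finset ι) (f : ι → F) :
    ‖∏ i ∈ s, f i‖ₑ = ∏ i ∈ s, ‖f i‖ₑ := by
  simp only [enorm_eq_nnnorm, nnnorm_prod, ENNReal.ofNNReal_finsetProd]

section FormEval

open Polynomial

variable {R : Type*} [CommRing R]

/-- The value at `z` of the binary form `∑ pᵢ x^(n-i) y^i` of degree `n` attached to the
polynomial `p`, as a linear functional of `p`. Since `Polynomial.homogenize` makes `0` the index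
of the variable of `p`, the two coordinates are swapped. -/
def formEval (n : ℕ) (z : R × R) : R[X] →ₗ[R] R :=
  (MvPolynomial.aeval ![z.2, z.1]).toLinearMap ∘ₗ homogenizeLM n

theorem formEval_X_pow {n i : ℕ} (h : i ≤ n) (z : R × R) :
    formEval n z (X ^ i) = z.1 ^ (n - i) * z.2 ^ i := by
  simp [formEval, homogenize_X_pow h, mul_comm]

theorem formEval_one (n : ℕ) (z : R × R) : formEval n z 1 = z.1 ^ n := by
  simpa using formEval_X_pow n.zero_le z

theorem formEval_mul {n m : ℕ} {p q : R[X]} (hp : p.natDegree ≤ n) (hq : q.natDegree ≤ m)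
    (z : R × R) : formEval (n + m) z (p * q) = formEval n z p * formEval m z q := by
  simp [formEval, homogenize_mul _ _ hp hq]

theorem formEval_C_mul (n : ℕ) (z : R × R) (a : R) (p : R[X]) :
    formEval n z (C a * p) = a * formEval n z p := by
  rw [C_mul', map_smul, smul_eq_mul]

theorem formEval_ofFn [DecidableEq R] (n : ℕ) {l : ℕ} (b : Fin l → R) (z : R × R) :
    formEval n z (ofFn l b) = ∑ i, b i * formEval n z (X ^ (i : ℕ)) := by
  simp only [ofFn_eq_sum_monomial, map_sum, ← C_mul_X_pow_eq_monomial, formEval_C_mul]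

theorem formEval_eq_sum {n l : ℕ} {p : R[X]} (hp : p.natDegree < l) (z : R × R) :
    formEval n z p = ∑ i : Fin l, p.coeff i * formEval n z (X ^ (i : ℕ)) := by
  classical
  conv_lhs => rw [← ofFn_comp_toFn_eq_id_of_natDegree_lt hp, formEval_ofFn]
  simp [toFn]

theorem formEval_map {S : Type*} [CommRing S] (f : R →+* S) (n : ℕ) (p : R[X])
    (z : R × R) : formEval n (f z.1, f z.2) (p.map f) = f (formEval n z p) := by
  have hcoord : ![f z.2, f z.1] = fun i => f (![z.2, z.1] i) := by
    ext i
    fin_cases i <;> rfl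
  change MvPolynomial.aeval ![f z.2, f z.1] ((p.map f).homogenize n) =
    f (MvPolynomial.aeval ![z.2, z.1] (p.homogenize n))
  rw [homogenize_map, MvPolynomial.map_aeval, MvPolynomial.aeval_def, MvPolynomial.eval₂_map,
    hcoord]
  rfl

end FormEval

section FormNorm

open Polynomial

variable {C : Type*} [NormedField C] {E : Set (C × C)}

/-- The sup norm on `E` of the binary form of degree `n` attached to the polynomial `p`. -/
def formNorm (E : Set (C × C)) (n : ℕ) (p : C[X]) : ℝ≥0∞ :=
  ⨆ z ∈ E, ‖formEval n z p‖ₑ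

theorem formNorm_le_iff {n : ℕ} {p : C[X]} {t : ℝ≥0∞} :
    formNorm E n p ≤ t ↔ ∀ z ∈ E, ‖formEval n z p‖ₑ ≤ t :=
  iSup₂_le_iff

theorem enorm_formEval_le {z : C × C} (hz : z ∈ E) (n : ℕ) (p : C[X]) :
    ‖formEval n z p‖ₑ ≤ formNorm E n p :=
  formNorm_le_iff.1 le_rfl z hz

theorem formNorm_add_le (n : ℕ) (p q : C[X]) :
    formNorm E n (p + q) ≤ formNorm E n p + formNorm E n q :=
  formNorm_le_iff.2 fun z hz => by
    rw [map_add]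
    exact (enorm_add_le _ _).trans <|
      add_le_add (enorm_formEval_le hz n p) (enorm_formEval_le hz n q)

theorem formNorm_sum_le {ι : Type*} (s : Finset ι) (n : ℕ) (p : ι → C[X]) :
    formNorm E n (∑ i ∈ s, p i) ≤ ∑ i ∈ s, formNorm E n (p i) :=
  Finset.le_sum_of_subadditive _ (by simp [formNorm]) (formNorm_add_le n) s p

theorem formNorm_C_mul (n : ℕ) (a : C) (p : C[X]) :
    formNorm E n (Polynomial.C a * p) = ‖a‖ₑ * formNorm E n p := by
  simp only [formNorm, formEval_C_mul, enorm_mul, ENNReal.mul_iSup]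

theorem formNorm_sub_le (n : ℕ) (p q : C[X]) :
    formNorm E n (p - q) ≤ formNorm E n p + formNorm E n q := by
  simpa [formNorm, sub_eq_add_neg] using formNorm_add_le (E := E) n p (-q)

theorem formNorm_mul_le {n m : ℕ} {p q : C[X]} (hp : p.natDegree ≤ n) (hq : q.natDegree ≤ m) :
    formNorm E (n + m) (p * q) ≤ formNorm E n p * formNorm E m q :=
  formNorm_le_iff.2 fun z hz => by
    rw [formEval_mul hp hq, enorm_mul]
    exact mul_le_mul' (enorm_formEval_le hz n p) (enorm_formEval_le hz m q)

theorem formNorm_prod_le {ι : Type*} (s : Finset ι) {n : ι → ℕ} {p : ι → C[X]}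
    (hp : ∀ i ∈ s, (p i).natDegree ≤ n i) :
    formNorm E (∑ i ∈ s, n i) (∏ i ∈ s, p i) ≤ ∏ i ∈ s, formNorm E (n i) (p i) := by
  classical
  induction s using Finset.induction_on with
  | empty => simp [formNorm_le_iff, formEval_one]
  | insert i s hi ih =>
    obtain ⟨hpi, hps⟩ := (Finset.forall_mem_insert _ _ _).1 hp
    rw [Finset.prod_insert hi, Finset.prod_insert hi, Finset.sum_insert hi]
    refine (formNorm_mul_le hpi ?_).trans (mul_le_mul_right (ih hps) _)
    exact (natDegree_prod_le _ _).trans (Finset.sum_le_sum hps)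

variable {R : ℝ≥0}

theorem formNorm_X_pow_le (hE : ∀ z ∈ E, ‖z‖₊ ≤ R) {i n : ℕ} (h : i ≤ n) :
    formNorm E n (X ^ i) ≤ R ^ n :=
  formNorm_le_iff.2 fun z hz => by
    have h₁ : ‖z.1‖ₑ ≤ R := mod_cast (norm_fst_le z).trans (hE z hz)
    have h₂ : ‖z.2‖ₑ ≤ R := mod_cast (norm_snd_le z).trans (hE z hz)
    calc ‖formEval n z (X ^ i)‖ₑ = ‖z.1‖ₑ ^ (n - i) * ‖z.2‖ₑ ^ i := by
          rw [formEval_X_pow h, enorm_mul, enorm_pow, enorm_pow]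
      _ ≤ (R : ℝ≥0∞) ^ (n - i) * (R : ℝ≥0∞) ^ i := by gcongr
      _ = (R : ℝ≥0∞) ^ n := by rw [← pow_add, Nat.sub_add_cancel h]

end FormNorm

section Chebyshev

open Polynomial

variable {K C : Type*} [Field K] [NormedField C] [Algebra K C] {E : Set (C × C)}

/-- The Chebyshev constant: the infimum of the sup norms on `E` of the binary forms of degree `n`
attached to the monic polynomials of degree `l` over `K`. -/
def chebyshev (K : Type*) [Field K] [Algebra K C] (E : Set (C × C)) (n l : ℕ) : ℝ≥0∞ :=
  ⨅ (p : K[X]) (_ : p.IsMonicOfDegree l), formNorm E n (p.map (algebraMap K C))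

theorem chebyshev_le_formNorm {l : ℕ} {p : K[X]} (hp : p.IsMonicOfDegree l) (n : ℕ) :
    chebyshev K E n l ≤ formNorm E n (p.map (algebraMap K C)) :=
  iInf₂_le p hp

theorem exists_formNorm_lt_of_chebyshev_lt {n l : ℕ} {t : ℝ≥0∞} (h : chebyshev K E n l < t) :
    ∃ p : K[X], p.IsMonicOfDegree l ∧ formNorm E n (p.map (algebraMap K C)) < t := by
  simpa only [chebyshev, iInf_lt_iff, exists_prop] using h

theorem enorm_coeff_mul_chebyshev_le {l : ℕ} {p : K[X]} (hp : p.natDegree ≤ l) (n : ℕ) :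
    ‖algebraMap K C (p.coeff l)‖ₑ * chebyshev K E n l ≤ formNorm E n (p.map (algebraMap K C)) := by
  rcases eq_or_ne (p.coeff l) 0 with h₀ | h₀
  · simp [h₀]
  have hmonic : (Polynomial.C (p.coeff l)⁻¹ * p).IsMonicOfDegree l :=
    (isMonicOfDegree_iff _ _).2 ⟨(natDegree_C_mul_le _ _).trans hp, by simp [h₀]⟩
  calc ‖algebraMap K C (p.coeff l)‖ₑ * chebyshev K E n l
      ≤ ‖algebraMap K C (p.coeff l)‖ₑ *
          formNorm E n ((Polynomial.C (p.coeff l)⁻¹ * p).map (algebraMap K C)) := by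
        gcongr
        exact chebyshev_le_formNorm hmonic n
    _ = formNorm E n (p.map (algebraMap K C)) := by
        rw [← formNorm_C_mul, ← map_C, ← Polynomial.map_mul, ← mul_assoc, ← Polynomial.C_mul,
          mul_inv_cancel₀ h₀, Polynomial.C_1, one_mul]

theorem isMonicOfDegree_map {p : K[X]} {l : ℕ} (hp : p.IsMonicOfDegree l) :
    (p.map (algebraMap K C)).IsMonicOfDegree l :=
  ⟨by rw [natDegree_map, hp.natDegree_eq], hp.monic.map _⟩

variable {R : ℝ≥0}

theorem chebyshev_le_pow (hE : ∀ z ∈ E, ‖z‖₊ ≤ R) {n l : ℕ} (h : l ≤ n) :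
    chebyshev K E n l ≤ R ^ n := by
  simpa using (chebyshev_le_formNorm (isMonicOfDegree_X_pow K l) n).trans
    (by simpa using formNorm_X_pow_le hE h)

theorem chebyshev_ne_top (hE : ∀ z ∈ E, ‖z‖₊ ≤ R) {n l : ℕ} (h : l ≤ n) :
    chebyshev K E n l ≠ ∞ :=
  ne_top_of_le_ne_top (ENNReal.pow_ne_top ENNReal.coe_ne_top) (chebyshev_le_pow hE h)

theorem chebyshev_add_le_mul (hE : ∀ z ∈ E, ‖z‖₊ ≤ R) {n l m j : ℕ} (hl : l ≤ n) (hj : j ≤ m) :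
    chebyshev K E (n + m) (l + j) ≤ chebyshev K E n l * chebyshev K E m j := by
  refine ENNReal.le_mul_of_forall_lt (.inr (chebyshev_ne_top hE hj))
    (.inl (chebyshev_ne_top hE hl)) fun s hs t ht => ?_
  obtain ⟨p, hp, hps⟩ := exists_formNorm_lt_of_chebyshev_lt hs
  obtain ⟨q, hq, hqt⟩ := exists_formNorm_lt_of_chebyshev_lt ht
  refine (chebyshev_le_formNorm (hp.mul hq) _).trans ?_
  rw [Polynomial.map_mul]
  exact (formNorm_mul_le ((isMonicOfDegree_map hp).natDegree_eq.trans_le hl)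
    ((isMonicOfDegree_map hq).natDegree_eq.trans_le hj)).trans (mul_le_mul' hps.le hqt.le)

theorem chebyshev_mul_le_pow (hE : ∀ z ∈ E, ‖z‖₊ ≤ R) {n l : ℕ} (hl : l ≤ n) (a : ℕ) :
    chebyshev K E (n * a) (l * a) ≤ chebyshev K E n l ^ a := by
  induction a with
  | zero => simpa using chebyshev_le_pow hE (le_refl 0)
  | succ a ih =>
    rw [mul_add_one, mul_add_one, pow_succ]
    exact (chebyshev_add_le_mul hE (Nat.mul_le_mul_right a hl) hl).trans (mul_le_mul_left ih _)

end Chebyshev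

section Determinant

open Polynomial

variable {C : Type*} [NormedField C] {E : Set (C × C)}

/-- The determinant of the values of the first `l` monomials of degree `n` at `l` points. -/
def formDet {F : Type*} [CommRing F] (n l : ℕ) (z : Fin l → F × F) : F :=
  (Matrix.of fun i j : Fin l => formEval n (z i) (X ^ (j : ℕ))).det

/-- The supremum of `formDet n l` over the `l`-tuples of points of `E`. -/
def maxDet (E : Set (C × C)) (n l : ℕ) : ℝ≥0∞ :=
  ⨆ z : Fin l → E, ‖formDet n l fun i => (z i : C × C)‖ₑ

theorem enorm_formDet_le_maxDet {l : ℕ} {z : Fin l → C × C} (hz : ∀ i, z i ∈ E) (n : ℕ) :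
    ‖formDet n l z‖ₑ ≤ maxDet E n l :=
  le_iSup (fun z : Fin l → E => ‖formDet n l fun i => (z i : C × C)‖ₑ) fun i => ⟨z i, hz i⟩

theorem exists_formEval_eq_formDet_snoc {F : Type*} [CommRing F] (n l : ℕ) (z : Fin l → F × F) :
    ∃ p : F[X], p.natDegree ≤ l ∧ p.coeff l = formDet n l z ∧
      ∀ w, formEval n w p = formDet n (l + 1) (Fin.snoc z w : Fin (l + 1) → F × F) := by
  classical
  -- The Laplace expansion of the determinant along its last row.
  set c : Fin (l + 1) → F := fun j => (-1) ^ (l + (j : ℕ)) *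
    (Matrix.of fun i k : Fin l => formEval n (z i) (X ^ (j.succAbove k : ℕ))).det with hc
  refine ⟨ofFn (l + 1) c, Nat.lt_succ_iff.1 (ofFn_natDegree_lt l.succ_pos c), ?_, fun w => ?_⟩
  · rw [ofFn_coeff_eq_val_of_lt c l.lt_succ_self]
    simp [hc, formDet, ← two_mul, Fin.succAbove, Fin.lt_def]
  · rw [formEval_ofFn, formDet, Matrix.det_succ_row _ (Fin.last l)]
    refine Finset.sum_congr rfl fun j _ => ?_
    rw [hc, Matrix.of_apply, Fin.snoc_last, Fin.val_last, mul_right_comm]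
    congr 3
    ext i k
    simp

theorem chebyshev_mul_maxDet_le (E : Set (C × C)) (n l : ℕ) :
    chebyshev C E n l * maxDet E n l ≤ maxDet E n (l + 1) := by
  rw [maxDet, ENNReal.mul_iSup]
  refine iSup_le fun z => ?_
  obtain ⟨p, hdeg, hcoeff, hval⟩ := exists_formEval_eq_formDet_snoc n l fun i => (z i : C × C)
  calc chebyshev C E n l * ‖formDet n l fun i => (z i : C × C)‖ₑ ≤ formNorm E n p := by
        rw [← hcoeff, mul_comm]
        simpa using enorm_coeff_mul_chebyshev_le (K := C) (E := E) hdeg n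
    _ ≤ maxDet E n (l + 1) := formNorm_le_iff.2 fun w hw => by
        rw [hval]
        exact enorm_formDet_le_maxDet (Fin.lastCases (by simpa using hw) (by simp)) n

theorem prod_chebyshev_le_maxDet (hne : E.Nonempty) (n l : ℕ) :
    ∏ j ∈ Finset.range l, chebyshev C E n j ≤ maxDet E n l := by
  induction l with
  | zero =>
    have : Nonempty E := hne.to_subtype
    simp [maxDet, formDet]
  | succ l ih =>
    rw [Finset.prod_range_succ, mul_comm]
    exact (mul_le_mul_right ih _).trans (chebyshev_mul_maxDet_le E n l)

theorem formDet_eq_det_of_isMonicOfDegree {F : Type*} [CommRing F] [Nontrivial F] (n : ℕ)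
    (z : Fin (n + 1) → F × F) {p : Fin (n + 1) → F[X]} (hp : ∀ j, (p j).IsMonicOfDegree j) :
    formDet n (n + 1) z = (Matrix.of fun i j => formEval n (z i) (p j)).det := by
  have hfactor : (Matrix.of fun i j => formEval n (z i) (p j)) =
      (Matrix.of fun i j : Fin (n + 1) => formEval n (z i) (X ^ (j : ℕ))) *
        (Matrix.of fun k j : Fin (n + 1) => (p j).coeff k) := by
    ext i j
    rw [Matrix.mul_apply, Matrix.of_apply,
      formEval_eq_sum ((hp j).natDegree_eq.trans_lt j.2)]
    exact Finset.sum_congr rfl fun k _ => mul_comm _ _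
  have hunipotent : (Matrix.of fun k j : Fin (n + 1) => (p j).coeff k).det = 1 := by
    rw [Matrix.det_of_isUpperTriangular]
    · exact Finset.prod_eq_one fun j _ => (((isMonicOfDegree_iff _ _).1 (hp j)).2)
    · exact fun i j hij => coeff_eq_zero_of_natDegree_lt ((hp j).natDegree_eq.trans_lt hij)
  rw [hfactor, Matrix.det_mul, hunipotent, mul_one, formDet]

theorem maxDet_le_factorial_mul_prod_formNorm (E : Set (C × C)) {n : ℕ}
    {p : Fin (n + 1) → C[X]} (hp : ∀ j, (p j).IsMonicOfDegree j) :
    maxDet E n (n + 1) ≤ (n + 1).factorial * ∏ j, formNorm E n (p j) := by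
  refine iSup_le fun z => ?_
  rw [formDet_eq_det_of_isMonicOfDegree n _ hp, Matrix.det_apply]
  have hterm (σ : Equiv.Perm (Fin (n + 1))) :
      ‖Equiv.Perm.sign σ • ∏ i, formEval n (z (σ i) : C × C) (p i)‖ₑ ≤
        ∏ j, formNorm E n (p j) := by
    rw [enorm_eq_nnnorm, nnnorm_units_zsmul, ← enorm_eq_nnnorm, enorm_finsetProd]
    exact Finset.prod_le_prod' fun i _ => enorm_formEval_le (z (σ i)).2 n (p i)
  calc _ ≤ ∑ σ : Equiv.Perm (Fin (n + 1)), _ := enorm_sum_le _ _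
    _ ≤ _ := Finset.sum_le_card_nsmul _ _ _ fun σ _ => hterm σ
    _ = _ := by simp [Finset.card_univ, Fintype.card_perm]

end Determinant

section Determinant

open Polynomial

variable {C : Type*} [NormedField C] {E : Set (C × C)}

theorem formDet_eq_prod_wedge {F : Type*} [Field F] (n : ℕ) (z : Fin (n + 1) → F × F) :
    formDet n (n + 1) z = ∏ i, ∏ j ∈ Finset.Ioi i, wedge (z i) (z j) := by
  have hmatrix : (Matrix.of fun i j : Fin (n + 1) => formEval n (z i) (X ^ (j : ℕ))) =
      Matrix.projVandermonde (fun i => (z i).2) (fun i => (z i).1) := by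
    ext i j
    rw [Matrix.of_apply, formEval_X_pow (Nat.lt_succ_iff.1 j.2), Matrix.projVandermonde_apply,
      mul_comm, Fin.val_rev, Nat.add_sub_add_right]
  rw [formDet, hmatrix, Matrix.det_projVandermonde]
  simp only [wedge, mul_comm]

theorem prod_enorm_wedge (n : ℕ) (z : Fin (n + 1) → C × C) :
    ∏ p : Fin (n + 1) × Fin (n + 1) with p.1 ≠ p.2, ‖wedge (z p.1) (z p.2)‖ₑ =
      ‖formDet n (n + 1) z‖ₑ ^ 2 := by
  have hsymm (x y : C × C) : ‖wedge x y‖ₑ = ‖wedge y x‖ₑ := by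
    rw [← enorm_neg]
    simp only [wedge, neg_sub, mul_comm]
  calc ∏ p : Fin (n + 1) × Fin (n + 1) with p.1 ≠ p.2, ‖wedge (z p.1) (z p.2)‖ₑ
      = ∏ i, ∏ j ∈ {i}ᶜ, ‖wedge (z j) (z i)‖ₑ := by
        rw [Finset.prod_filter, ← Finset.univ_product_univ, Finset.prod_product_right]
        simp only [← Finset.prod_filter, Finset.compl_singleton, Finset.filter_ne']
    _ = ∏ i, ∏ j ∈ Finset.Ioi i, ‖wedge (z i) (z j)‖ₑ * ‖wedge (z i) (z j)‖ₑ := by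
        rw [← Finset.prod_prod_Ioi_mul_eq_prod_prod_off_diag fun i j => ‖wedge (z i) (z j)‖ₑ]
        simp only [fun i j => hsymm (z j) (z i)]
    _ = ‖formDet n (n + 1) z‖ₑ ^ 2 := by
        simp only [formDet_eq_prod_wedge, enorm_finsetProd, Finset.prod_mul_distrib, sq]

end Determinant

section ChebyshevProd

open Polynomial

theorem tendsto_prod_add_nhdsGT_zero {ι : Type*} (s : Finset ι) {T : ι → ℝ≥0∞}
    (hT : ∀ i ∈ s, T i ≠ ∞) :
    Tendsto (fun ε : ℝ≥0∞ => ∏ i ∈ s, (T i + ε)) (𝓝[>] 0) (𝓝 (∏ i ∈ s, T i)) := by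
  refine ENNReal.tendsto_finsetProd_of_ne_top s (fun i _ => ?_) hT
  have : Tendsto (fun ε : ℝ≥0∞ => T i + ε) (𝓝 0) (𝓝 (T i + 0)) := tendsto_id.const_add (T i)
  simpa using this.mono_left nhdsWithin_le_nhds

variable {K C : Type*} [Field K] [NormedField C] [Algebra K C] {E : Set (C × C)} {R : ℝ≥0}

/-- The product of the Chebyshev constants of the binary forms of degree `n`. -/
def chebyshevProd (K : Type*) [Field K] [Algebra K C] (E : Set (C × C)) (n : ℕ) : ℝ≥0∞ :=
  ∏ l ∈ Finset.range (n + 1), chebyshev K E n l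

theorem chebyshevProd_ne_top (hE : ∀ z ∈ E, ‖z‖₊ ≤ R) (n : ℕ) : chebyshevProd K E n ≠ ∞ :=
  ENNReal.prod_ne_top fun _ hl => chebyshev_ne_top hE (Finset.mem_range_succ_iff.1 hl)

theorem exists_formNorm_lt_chebyshev_add (hE : ∀ z ∈ E, ‖z‖₊ ≤ R) (n : ℕ) {ε : ℝ≥0∞} (hε : ε ≠ 0) :
    ∃ p : Fin (n + 1) → K[X], ∀ l, (p l).IsMonicOfDegree l ∧
      formNorm E n ((p l).map (algebraMap K C)) < chebyshev K E n l + ε := by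
  choose p hp using fun l : Fin (n + 1) => exists_formNorm_lt_of_chebyshev_lt (K := K)
    (ENNReal.lt_add_right (chebyshev_ne_top hE (Nat.lt_succ_iff.1 l.2)) hε)
  exact ⟨p, hp⟩

theorem maxDet_le_factorial_mul_chebyshevProd (hE : ∀ z ∈ E, ‖z‖₊ ≤ R) (n : ℕ) :
    maxDet E n (n + 1) ≤ (n + 1).factorial * chebyshevProd K E n := by
  have hlim := ENNReal.Tendsto.const_mul (a := ((n + 1).factorial : ℝ≥0∞))
    (tendsto_prod_add_nhdsGT_zero (Finset.range (n + 1)) fun l hl =>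
      chebyshev_ne_top (K := K) hE (Finset.mem_range_succ_iff.1 hl))
    (.inr (ENNReal.natCast_ne_top _))
  refine ge_of_tendsto hlim ?_
  filter_upwards [self_mem_nhdsWithin] with ε hε
  obtain ⟨p, hp⟩ := exists_formNorm_lt_chebyshev_add (K := K) hE n hε.ne'
  rw [Finset.prod_range]
  exact (maxDet_le_factorial_mul_prod_formNorm E fun l => isMonicOfDegree_map (hp l).1).trans
    (mul_le_mul_right (Finset.prod_le_prod' fun l _ => (hp l).2.le) _)

end ChebyshevProd

section Fubini

theorem measurable_snoc {K : Type*} [MeasurableSpace K] {N : ℕ} (x : K) :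
    Measurable fun b : Fin N → K => (Fin.snoc b x : Fin (N + 1) → K) :=
  measurable_pi_iff.2 <| Fin.lastCases (by simp) fun i => by simpa using measurable_pi_apply i

variable {K : Type*} [MeasurableSpace K] {μ : Measure K} [SigmaFinite μ] {N : ℕ}

theorem pi_eq_lintegral_snoc {S : Set (Fin (N + 1) → K)} (hS : MeasurableSet S) :
    Measure.pi (fun _ : Fin (N + 1) => μ) S =
      ∫⁻ x, Measure.pi (fun _ : Fin N => μ) {b | (Fin.snoc b x : Fin (N + 1) → K) ∈ S} ∂μ := by
  have h := (measurePreserving_piFinSuccAbove (fun _ : Fin (N + 1) => μ) (Fin.last N)).symm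
  rw [← h.measure_preimage hS.nullMeasurableSet, Measure.prod_apply (h.measurable hS)]
  refine lintegral_congr fun x => congrArg _ (Set.ext fun b => ?_)
  simp [MeasurableEquiv.piFinSuccAbove, Fin.insertNthEquiv, Fin.insertNth_last']

theorem pi_le_mul_of_snoc {S : Set (Fin (N + 1) → K)} (hS : MeasurableSet S) {T : Set K}
    (hT : MeasurableSet T) {m : ℝ≥0∞} (hST : ∀ b x, (Fin.snoc b x : Fin (N + 1) → K) ∈ S → x ∈ T)
    (hm : ∀ x ∈ T,
      Measure.pi (fun _ : Fin N => μ) {b | (Fin.snoc b x : Fin (N + 1) → K) ∈ S} ≤ m) :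
    Measure.pi (fun _ : Fin (N + 1) => μ) S ≤ m * μ T := by
  rw [pi_eq_lintegral_snoc hS, ← lintegral_indicator_const hT]
  refine lintegral_mono fun x => ?_
  by_cases hx : x ∈ T
  · simpa [hx] using hm x hx
  · have hempty : {b | (Fin.snoc b x : Fin (N + 1) → K) ∈ S} = ∅ :=
      Set.eq_empty_of_forall_notMem fun b hb => hx (hST b x hb)
    simp [hempty]

theorem mul_le_pi_of_snoc {S : Set (Fin (N + 1) → K)} (hS : MeasurableSet S) {T : Set K}
    (hT : MeasurableSet T) {m : ℝ≥0∞}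
    (hm : ∀ x ∈ T,
      m ≤ Measure.pi (fun _ : Fin N => μ) {b | (Fin.snoc b x : Fin (N + 1) → K) ∈ S}) :
    m * μ T ≤ Measure.pi (fun _ : Fin (N + 1) => μ) S := by
  rw [pi_eq_lintegral_snoc hS, ← lintegral_indicator_const hT]
  exact lintegral_mono fun x => Set.indicator_le (fun x hx => hm x hx) x

end Fubini

section BallEstimates

variable {K : Type*} [NormedField K] [MeasurableSpace K] [OpensMeasurableSpace K]
  {μ : Measure K} [SigmaFinite μ]

theorem pi_le_prod_of_dist_le {N : ℕ} {S : Set (Fin N → K)} (hS : MeasurableSet S)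
    {r : Fin N → ℝ} {M : Fin N → ℝ≥0∞} (hM : ∀ l x, μ (Metric.closedBall x (r l)) ≤ M l)
    (h : ∀ a ∈ S, ∀ b ∈ S, ∀ l, (∀ i, l < i → a i = b i) → dist (a l) (b l) ≤ r l) :
    Measure.pi (fun _ : Fin N => μ) S ≤ ∏ l, M l := by
  induction N with
  | zero => simpa using measure_mono (μ := Measure.pi fun _ : Fin 0 => μ) (Set.subset_univ S)
  | succ N ih =>
    rcases S.eq_empty_or_nonempty with rfl | ⟨a₀, ha₀⟩
    · simp
    rw [Fin.prod_univ_castSucc]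
    refine (pi_le_mul_of_snoc hS (T := Metric.closedBall (a₀ (Fin.last N)) (r (Fin.last N)))
      Metric.isClosed_closedBall.measurableSet (fun b x hb => ?_) fun x _ => ?_).trans
      (mul_le_mul_right (hM _ _) _)
    · simpa using h _ hb _ ha₀ (Fin.last N) fun i hi => absurd hi (Fin.le_last i).not_gt
    · refine ih (measurable_snoc x hS) (fun l y => hM _ y) fun a ha b hb l hl => ?_
      have := h _ ha _ hb l.castSucc <| Fin.lastCases (by simp) fun i hi => by
        simpa using hl i (by simpa using hi)
      simpa using this

theorem prod_le_pi_of_shear {N : ℕ} {S : Set (Fin N → K)} (hS : MeasurableSet S)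
    {r : Fin N → ℝ} {M : Fin N → ℝ≥0∞} (hM : ∀ l x, M l ≤ μ (Metric.closedBall x (r l)))
    (g : Fin N → (Fin N → K) → K) (hg : ∀ l a b, (∀ i, l < i → a i = b i) → g l a = g l b)
    (h : ∀ a : Fin N → K, (∀ l, ‖a l‖ ≤ r l) → (fun l => a l + g l a) ∈ S) :
    ∏ l, M l ≤ Measure.pi (fun _ : Fin N => μ) S := by
  induction N with
  | zero =>
    have hS_univ : S = Set.univ := Set.eq_univ_of_forall fun a => by
      simpa only [Subsingleton.elim _ a] using h a fun l => l.elim0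
    simp [hS_univ]
  | succ N ih =>
    set c := g (Fin.last N) 0
    have hlast (a) : g (Fin.last N) a = c :=
      hg _ _ _ fun i hi => absurd hi (Fin.le_last i).not_gt
    rw [Fin.prod_univ_castSucc]
    refine (mul_le_mul_right (hM (Fin.last N) c) _).trans
      (mul_le_pi_of_snoc hS Metric.isClosed_closedBall.measurableSet fun x hx => ?_)
    refine ih (measurable_snoc x hS) (fun l y => hM _ y)
      (fun l a => g l.castSucc (Fin.snoc a (x - c))) (fun l a b hl => ?_) fun a ha => ?_
    · exact hg _ _ _ <| Fin.lastCases (by simp) fun i hi => by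
        simpa using hl i (by simpa using hi)
    · have hmem := h (Fin.snoc a (x - c)) <| Fin.lastCases
        (by simpa [dist_eq_norm] using hx) fun l => by simpa using ha l
      refine Set.mem_preimage.2 ?_
      convert hmem using 1
      funext l
      refine Fin.lastCases ?_ (fun l => ?_) l
      · simp [hlast]
      · simp

end BallEstimates

section UnitForms

open Polynomial

theorem isHomogeneous_binaryForm {K : Type*} [Field K] {n : ℕ} (b : Fin (n + 1) → K) :
    (binaryForm n b).IsHomogeneous n := by
  refine MvPolynomial.IsHomogeneous.sum _ _ _ fun i _ => ?_
  have h := ((MvPolynomial.isHomogeneous_C (Fin 2) (b i)).mul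
    (MvPolynomial.isHomogeneous_X_pow 0 (n - i))).mul (MvPolynomial.isHomogeneous_X_pow 1 (i : ℕ))
  rwa [zero_add, Nat.sub_add_cancel (Nat.lt_succ_iff.1 i.2)] at h

variable {K C : Type*} [Field K] [DecidableEq K] [NormedField C] [Algebra K C]

theorem formEval_map_ofFn (n : ℕ) {l : ℕ} (b : Fin l → K) (z : C × C) :
    formEval n z ((ofFn l b).map (algebraMap K C)) =
      ∑ i, algebraMap K C (b i) * formEval n z (X ^ (i : ℕ)) := by
  rw [ofFn_eq_sum_monomial, Polynomial.map_sum, map_sum]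
  refine Finset.sum_congr rfl fun i _ => ?_
  rw [map_monomial, ← C_mul_X_pow_eq_monomial, formEval_C_mul]

theorem aeval_binaryForm {n : ℕ} (b : Fin (n + 1) → K) (z : C × C) :
    MvPolynomial.aeval ![z.1, z.2] (binaryForm n b) =
      formEval n z ((ofFn (n + 1) b).map (algebraMap K C)) := by
  rw [formEval_map_ofFn]
  simp only [binaryForm, map_sum, map_mul, map_pow, MvPolynomial.aeval_C, MvPolynomial.aeval_X]
  refine Finset.sum_congr rfl fun i _ => ?_
  simp [formEval_X_pow (Nat.lt_succ_iff.1 i.2), mul_assoc]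

theorem binaryForm_mem_unitForms {E : Set (C × C)} {δ : ℕ} (hδ : δ ≠ 0) {n : ℕ}
    (b : Fin (n + 1) → K) :
    binaryForm n b ∈ unitForms K (fun z : C => ‖z‖ ^ δ) E n ↔
      formNorm E n ((ofFn (n + 1) b).map (algebraMap K C)) ≤ 1 := by
  simp only [unitForms, Set.mem_ofPred_eq, isHomogeneous_binaryForm, true_and, supNorm,
    iSup_le_iff, aeval_binaryForm, formNorm_le_iff]
  refine forall₂_congr fun z _ => ?_
  rw [ENNReal.ofReal_le_one, pow_le_one_iff_of_nonneg (norm_nonneg _) hδ, ← ofReal_norm,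
    ENNReal.ofReal_le_one]

end UnitForms

section FormVolume

open Polynomial

variable {K C : Type*} [NormedField K] [NormedField C] [NormedAlgebra K C] {E : Set (C × C)}
  {δ : ℕ}

theorem measurableSet_unitForms [MeasurableSpace K] [BorelSpace K] [SecondCountableTopology K]
    (E : Set (C × C)) (hδ : δ ≠ 0) (n : ℕ) :
    MeasurableSet (binaryForm n ⁻¹' unitForms K (fun z : C => ‖z‖ ^ δ) E n) := by
  classical
  have hset : binaryForm n ⁻¹' unitForms K (fun z : C => ‖z‖ ^ δ) E n =
      ⋂ z ∈ E, {b | ‖formEval n z ((ofFn (n + 1) b).map (algebraMap K C))‖ₑ ≤ 1} := by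
    ext b
    simp [binaryForm_mem_unitForms hδ, formNorm_le_iff]
  rw [hset]
  refine (isClosed_biInter fun z _ => ?_).measurableSet
  simp only [formEval_map_ofFn]
  have := continuous_algebraMap K C
  exact isClosed_le (by fun_prop) continuous_const

theorem enorm_sub_mul_chebyshev_le [DecidableEq K] {n : ℕ} {a b : Fin (n + 1) → K}
    (ha : formNorm E n ((ofFn (n + 1) a).map (algebraMap K C)) ≤ 1)
    (hb : formNorm E n ((ofFn (n + 1) b).map (algebraMap K C)) ≤ 1)
    {l : Fin (n + 1)} (hab : ∀ i, l < i → a i = b i) :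
    ‖a l - b l‖ₑ * chebyshev K E n l ≤ 2 := by
  have hdeg : (ofFn (n + 1) (a - b)).natDegree ≤ l :=
    natDegree_le_iff_coeff_eq_zero.2 fun k hk => by
      rcases lt_or_ge k (n + 1) with hkn | hkn
      · simp [ofFn_coeff_eq_val_of_lt _ hkn, hab ⟨k, hkn⟩ hk]
      · exact ofFn_coeff_eq_zero_of_ge _ hkn
  calc ‖a l - b l‖ₑ * chebyshev K E n l
      = ‖algebraMap K C ((ofFn (n + 1) (a - b)).coeff l)‖ₑ * chebyshev K E n l := by
        rw [ofFn_coeff_eq_val_of_lt _ l.2, ← ofReal_norm, ← ofReal_norm, norm_algebraMap']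
        rfl
    _ ≤ formNorm E n ((ofFn (n + 1) (a - b)).map (algebraMap K C)) :=
        enorm_coeff_mul_chebyshev_le hdeg n
    _ ≤ 1 + 1 := by
        rw [map_sub, Polynomial.map_sub]
        exact (formNorm_sub_le n _ _).trans (add_le_add ha hb)
    _ = 2 := one_add_one_eq_two

theorem ofFn_add_sum_mul_coeff {F : Type*} [CommRing F] [Nontrivial F] [DecidableEq F] {n : ℕ}
    {p : Fin n → F[X]} (hp : ∀ l, (p l).IsMonicOfDegree l) (a : Fin n → F) :
    ofFn n (fun l => a l + ∑ k ∈ Finset.Ioi l, a k * (p k).coeff l) =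
      ∑ k, Polynomial.C (a k) * p k := by
  ext i
  rw [finsetSum_coeff]
  simp only [coeff_C_mul]
  rcases lt_or_ge i n with hi | hi
  · have hmonic : (p ⟨i, hi⟩).coeff i = 1 := ((isMonicOfDegree_iff _ _).1 (hp ⟨i, hi⟩)).2
    have hvanish (k : Fin n) (hk : k ∉ Finset.Ici ⟨i, hi⟩) : a k * (p k).coeff i = 0 := by
      rw [coeff_eq_zero_of_natDegree_lt, mul_zero]
      rw [(hp k).natDegree_eq]
      simpa [Fin.lt_def] using hk
    rw [ofFn_coeff_eq_val_of_lt _ hi,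
      ← Finset.sum_subset (Finset.subset_univ _) fun k _ => hvanish k, ← Finset.Ioi_insert,
      Finset.sum_insert Finset.notMem_Ioi_self, hmonic, mul_one]
  · rw [ofFn_coeff_eq_zero_of_ge _ hi]
    refine (Finset.sum_eq_zero fun k _ => ?_).symm
    rw [coeff_eq_zero_of_natDegree_lt ((hp k).natDegree_eq.trans_lt (k.2.trans_le hi)), mul_zero]

variable [MeasurableSpace K] [BorelSpace K] [SecondCountableTopology K]
  {vol : Measure K} [SigmaFinite vol] {R : ℝ≥0}

theorem formVolume_le_div_chebyshevProd (hE : ∀ z ∈ E, ‖z‖₊ ≤ R) (hδ : δ ≠ 0) {A : ℝ≥0∞}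
    (hA₀ : A ≠ 0) (hA : ∀ x, ∀ r : ℝ≥0, r ≠ 0 → vol (Metric.closedBall x r) ≤ A * r ^ δ) (n : ℕ) :
    formVolume vol n (unitForms K (fun z : C => ‖z‖ ^ δ) E n) ≤
      (A * 2 ^ δ) ^ (n + 1) / chebyshevProd K E n ^ δ := by
  classical
  rcases eq_or_ne (chebyshevProd K E n) 0 with hP | hP
  · rw [hP, zero_pow hδ, ENNReal.div_zero (by simp [hA₀])]
    exact le_top
  rw [chebyshevProd, Finset.prod_range, Finset.prod_ne_zero_iff] at hP
  have hT₀ (l : Fin (n + 1)) : chebyshev K E n l ≠ 0 := hP l (Finset.mem_univ l)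
  have hT (l : Fin (n + 1)) : chebyshev K E n l ≠ ∞ := chebyshev_ne_top hE (Nat.lt_succ_iff.1 l.2)
  have hr (l : Fin (n + 1)) : ((2 / chebyshev K E n l).toNNReal : ℝ≥0∞) = 2 / chebyshev K E n l :=
    ENNReal.coe_toNNReal (ENNReal.div_ne_top ENNReal.ofNat_ne_top (hT₀ l))
  have hr₀ (l : Fin (n + 1)) : (2 / chebyshev K E n l).toNNReal ≠ 0 := by
    rw [← ENNReal.coe_ne_zero, hr]
    exact ENNReal.div_ne_zero.2 ⟨two_ne_zero, hT l⟩
  calc formVolume vol n (unitForms K (fun z : C => ‖z‖ ^ δ) E n)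
      ≤ ∏ l : Fin (n + 1), A * (2 / chebyshev K E n l) ^ δ := by
        refine pi_le_prod_of_dist_le (measurableSet_unitForms E hδ n)
          (r := fun l => (2 / chebyshev K E n l).toNNReal)
          (fun l x => (hA x _ (hr₀ l)).trans_eq (by rw [hr])) fun a ha b hb l hab => ?_
        rw [Set.mem_preimage, binaryForm_mem_unitForms hδ] at ha hb
        rw [dist_eq_norm, ← coe_nnnorm, NNReal.coe_le_coe, ← ENNReal.coe_le_coe, hr,
          ENNReal.le_div_iff_mul_le (.inl (hT₀ l)) (.inl (hT l))]
        exact enorm_sub_mul_chebyshev_le ha hb hab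
    _ = (A * 2 ^ δ) ^ (n + 1) / chebyshevProd K E n ^ δ := by
        rw [Finset.prod_mul_distrib, Finset.prod_pow,
          ENNReal.prod_div_distrib fun l _ _ _ _ => .inl (hT₀ l), chebyshevProd,
          Finset.prod_range]
        simp only [Finset.prod_const, Finset.card_univ, Fintype.card_fin, ENNReal.div_eq_inv_mul,
          mul_pow, ENNReal.inv_pow]
        ring

theorem le_formVolume_of_sum_le_one (hδ : δ ≠ 0) {B : ℝ≥0∞}
    (hB : ∀ x, ∀ r : ℝ≥0, r ≠ 0 → B * r ^ δ ≤ vol (Metric.closedBall x r)) {n : ℕ}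
    {p : Fin (n + 1) → K[X]} (hp : ∀ l, (p l).IsMonicOfDegree l) {r : Fin (n + 1) → ℝ≥0}
    (hr₀ : ∀ l, r l ≠ 0) (hr : ∑ l, r l * formNorm E n ((p l).map (algebraMap K C)) ≤ 1) :
    B ^ (n + 1) * (∏ l, (r l : ℝ≥0∞)) ^ δ ≤
      formVolume vol n (unitForms K (fun z : C => ‖z‖ ^ δ) E n) := by
  classical
  calc B ^ (n + 1) * (∏ l, (r l : ℝ≥0∞)) ^ δ = ∏ l, B * (r l : ℝ≥0∞) ^ δ := by
        simp [Finset.prod_mul_distrib, Finset.prod_pow]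
    _ ≤ _ := by
        refine prod_le_pi_of_shear (measurableSet_unitForms E hδ n) (fun l x => hB x _ (hr₀ l))
          (fun l a => ∑ k ∈ Finset.Ioi l, a k * (p k).coeff l) (fun l a b hab => ?_) fun a ha => ?_
        · exact Finset.sum_congr rfl fun k hk => by rw [hab k (Finset.mem_Ioi.1 hk)]
        rw [Set.mem_preimage, binaryForm_mem_unitForms hδ, ofFn_add_sum_mul_coeff hp,
          Polynomial.map_sum]
        refine (formNorm_sum_le _ n _).trans ((Finset.sum_le_sum fun l _ => ?_).trans hr)
        rw [Polynomial.map_mul, map_C, formNorm_C_mul]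
        gcongr
        rw [← ofReal_norm, norm_algebraMap', ENNReal.ofReal_le_coe]
        exact ha l

theorem div_prod_le_formVolume (hδ : δ ≠ 0) {B : ℝ≥0∞}
    (hB : ∀ x, ∀ r : ℝ≥0, r ≠ 0 → B * r ^ δ ≤ vol (Metric.closedBall x r)) {n : ℕ}
    {p : Fin (n + 1) → K[X]} (hp : ∀ l, (p l).IsMonicOfDegree l) {t : Fin (n + 1) → ℝ≥0∞}
    (ht₀ : ∀ l, t l ≠ 0) (ht : ∀ l, t l ≠ ∞)
    (hpt : ∀ l, formNorm E n ((p l).map (algebraMap K C)) ≤ t l) :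
    B ^ (n + 1) / ((n + 1 : ℕ) ^ (n + 1) * ∏ l, t l) ^ δ ≤
      formVolume vol n (unitForms K (fun z : C => ‖z‖ ^ δ) E n) := by
  set x : Fin (n + 1) → ℝ≥0∞ := fun l => (n + 1 : ℕ) * t l with hx
  have hx₀ (l) : x l ≠ 0 := mul_ne_zero (by simp) (ht₀ l)
  have hxT (l) : x l ≠ ∞ := ENNReal.mul_ne_top (ENNReal.natCast_ne_top _) (ht l)
  have hr (l) : ((x l)⁻¹.toNNReal : ℝ≥0∞) = (x l)⁻¹ :=
    ENNReal.coe_toNNReal (ENNReal.inv_ne_top.2 (hx₀ l))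
  calc B ^ (n + 1) / ((n + 1 : ℕ) ^ (n + 1) * ∏ l, t l) ^ δ
      = B ^ (n + 1) * (∏ l, ((x l)⁻¹.toNNReal : ℝ≥0∞)) ^ δ := by
        simp only [hr]
        rw [← ENNReal.prod_inv_distrib fun l _ _ _ _ => .inl (hx₀ l), ← ENNReal.inv_pow,
          ← div_eq_mul_inv, hx, Finset.prod_mul_distrib, Finset.prod_const, Finset.card_univ,
          Fintype.card_fin]
    _ ≤ _ := le_formVolume_of_sum_le_one hδ hB hp
        (fun l => ENNReal.coe_ne_zero.1 (by simpa only [hr] using ENNReal.inv_ne_zero.2 (hxT l))) ?_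
  calc ∑ l, ((x l)⁻¹.toNNReal : ℝ≥0∞) * formNorm E n ((p l).map (algebraMap K C))
      ≤ ∑ _ : Fin (n + 1), ((n + 1 : ℕ) : ℝ≥0∞)⁻¹ := by
        refine Finset.sum_le_sum fun l _ => ?_
        rw [hr, ← ENNReal.div_eq_inv_mul, ENNReal.div_le_iff (hx₀ l) (hxT l), hx, ← mul_assoc,
          ENNReal.inv_mul_cancel (by simp) (ENNReal.natCast_ne_top _), one_mul]
        exact hpt l
    _ = 1 := by
        rw [Finset.sum_const, Finset.card_univ, Fintype.card_fin, nsmul_eq_mul,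
          ENNReal.mul_inv_cancel (by simp) (ENNReal.natCast_ne_top _)]

theorem div_chebyshevProd_le_formVolume (hE : ∀ z ∈ E, ‖z‖₊ ≤ R) (hδ : δ ≠ 0) {B : ℝ≥0∞}
    (hB : ∀ x, ∀ r : ℝ≥0, r ≠ 0 → B * r ^ δ ≤ vol (Metric.closedBall x r)) (n : ℕ) :
    B ^ (n + 1) / ((n + 1 : ℕ) ^ (n + 1) * chebyshevProd K E n) ^ δ ≤
      formVolume vol n (unitForms K (fun z : C => ‖z‖ ^ δ) E n) := by
  have hT (l : Fin (n + 1)) : chebyshev K E n l ≠ ∞ := chebyshev_ne_top hE (Nat.lt_succ_iff.1 l.2)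
  have hlim : Tendsto (fun ε : ℝ≥0∞ => B ^ (n + 1) / ((n + 1 : ℕ) ^ (n + 1) *
      ∏ l : Fin (n + 1), (chebyshev K E n l + ε)) ^ δ) (𝓝[>] 0)
      (𝓝 (B ^ (n + 1) / ((n + 1 : ℕ) ^ (n + 1) * chebyshevProd K E n) ^ δ)) := by
    rw [chebyshevProd, Finset.prod_range]
    have hprod : ∏ l : Fin (n + 1), chebyshev K E n l ≠ ∞ := ENNReal.prod_ne_top fun l _ => hT l
    exact ENNReal.Tendsto.const_div (ENNReal.Tendsto.pow (ENNReal.Tendsto.const_mul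
      (tendsto_prod_add_nhdsGT_zero _ fun l _ => hT l) (.inr (by finiteness))))
      (.inl (by finiteness))
  refine le_of_tendsto hlim ?_
  filter_upwards [self_mem_nhdsWithin, nhdsWithin_le_nhds (eventually_lt_nhds ENNReal.zero_lt_top)]
    with ε (hε : 0 < ε) hε'
  obtain ⟨p, hp⟩ := exists_formNorm_lt_chebyshev_add (K := K) hE n hε.ne'
  exact div_prod_le_formVolume hδ hB (fun l => (hp l).1) (fun l => by simp [hε.ne'])
    (fun l => ENNReal.add_ne_top.2 ⟨hT l, hε'.ne⟩) fun l => (hp l).2.le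

end FormVolume

section ScaledLog

/-- The logarithm of a quantity attached to the binary forms of degree `n`, on the scale on which
the capacities are defined: the determinants and volumes occurring here grow like `exp (c n² / 2)`.
Dividing by `(n + 1)²` instead of `n²` gives the same limits and avoids the degree `n = 0`. -/
def scaledLog (n : ℕ) (t : ℝ≥0∞) : EReal :=
  ((2 / (n + 1) ^ 2 : ℝ) : EReal) * ENNReal.log t

theorem scaledLog_mono (n : ℕ) : Monotone (scaledLog n) := fun _ _ h =>
  mul_le_mul_of_nonneg_left (ENNReal.log_monotone h) (EReal.coe_nonneg.2 (by positivity))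

theorem continuous_scaledLog (n : ℕ) : Continuous (scaledLog n) :=
  continuous_iff_continuousAt.2 fun _ => EReal.Tendsto.const_mul (ENNReal.continuous_log.tendsto _)
    (.inl (EReal.coe_ne_bot _)) (.inl (EReal.coe_ne_top _))

theorem scaledLog_mul (n : ℕ) (s t : ℝ≥0∞) :
    scaledLog n (s * t) = scaledLog n s + scaledLog n t := by
  rw [scaledLog, ENNReal.log_mul_add, EReal.left_distrib_of_nonneg_of_ne_top
    (EReal.coe_nonneg.2 (by positivity)) (EReal.coe_ne_top _)]
  rfl

theorem scaledLog_pow (n : ℕ) (t : ℝ≥0∞) (k : ℕ) : scaledLog n (t ^ k) = k * scaledLog n t := by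
  rw [scaledLog, ENNReal.log_pow, mul_left_comm]
  rfl

theorem scaledLog_inv (n : ℕ) (t : ℝ≥0∞) : scaledLog n t⁻¹ = -scaledLog n t := by
  rw [scaledLog, ENNReal.log_inv, mul_neg]
  rfl

theorem scaledLog_coe (n : ℕ) {t : ℝ≥0} (ht : t ≠ 0) :
    scaledLog n t = ((2 / (n + 1) ^ 2 * Real.log t : ℝ) : EReal) := by
  rw [scaledLog, ENNReal.log_of_nnreal ht, EReal.coe_mul]

theorem scaledLog_ne_top (n : ℕ) {t : ℝ≥0∞} (ht : t ≠ ∞) : scaledLog n t ≠ ⊤ := by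
  lift t to ℝ≥0 using ht
  rcases eq_or_ne t 0 with rfl | h₀
  · rw [scaledLog, ENNReal.coe_zero, ENNReal.log_zero, EReal.coe_mul_bot_of_pos (by positivity)]
    exact bot_ne_top
  · exact scaledLog_coe n h₀ ▸ EReal.coe_ne_top _

theorem tendsto_log_succ_div_succ :
    Tendsto (fun n : ℕ => Real.log (n + 1 : ℕ) / (n + 1 : ℕ)) atTop (𝓝 0) :=
  (Real.isLittleO_log_id_atTop.tendsto_div_nhds_zero.comp tendsto_natCast_atTop_atTop).comp
    (tendsto_add_atTop_nat 1)

theorem tendsto_scaledLog_pow_succ {t : ℝ≥0} (ht : t ≠ 0) :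
    Tendsto (fun n => scaledLog n ((t : ℝ≥0∞) ^ (n + 1))) atTop (𝓝 0) := by
  have hreal (n : ℕ) : scaledLog n ((t : ℝ≥0∞) ^ (n + 1)) =
      ((2 * Real.log t * (1 / ((n : ℝ) + 1)) : ℝ) : EReal) := by
    rw [← ENNReal.coe_pow, scaledLog_coe n (pow_ne_zero _ ht), NNReal.coe_pow, Real.log_pow]
    congr 1
    push_cast
    field_simp
  simp only [hreal]
  refine EReal.tendsto_coe.2 ?_
  simpa using tendsto_one_div_add_atTop_nhds_zero_nat.const_mul (2 * Real.log t)

theorem tendsto_scaledLog_succ_pow_succ :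
    Tendsto (fun n => scaledLog n (((n + 1 : ℕ) : ℝ≥0∞) ^ (n + 1))) atTop (𝓝 0) := by
  have hreal (n : ℕ) : scaledLog n (((n + 1 : ℕ) : ℝ≥0∞) ^ (n + 1)) =
      ((2 * (Real.log (n + 1 : ℕ) / (n + 1 : ℕ)) : ℝ) : EReal) := by
    rw [← ENNReal.coe_natCast, ← ENNReal.coe_pow,
      scaledLog_coe n (pow_ne_zero _ (Nat.cast_ne_zero.2 n.succ_ne_zero)), NNReal.coe_pow,
      Real.log_pow, NNReal.coe_natCast]
    congr 1
    push_cast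
    field_simp
  simp only [hreal]
  refine EReal.tendsto_coe.2 ?_
  simpa using tendsto_log_succ_div_succ.const_mul 2

end ScaledLog

section BlockEstimate

theorem prod_range_mul_comp_div {M : Type*} [CommMonoid M] (f : ℕ → M) {a : ℕ} (ha : 0 < a)
    (k : ℕ) : ∏ l ∈ Finset.range (k * a), f (l / a) = ∏ j ∈ Finset.range k, f j ^ a := by
  induction k with
  | zero => simp
  | succ k ih =>
    have hblock : ∀ i ∈ Finset.range a, f ((k * a + i) / a) = f k := fun i hi => by
      rw [mul_comm k, Nat.mul_add_div ha, Nat.div_eq_of_lt (Finset.mem_range.1 hi), add_zero]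
    rw [add_one_mul, Finset.prod_range_add, ih, Finset.prod_range_succ,
      Finset.prod_congr rfl hblock, Finset.prod_const, Finset.card_range]

theorem prod_range_min_comp_div {M : Type*} [CommMonoid M] (f : ℕ → M) {a : ℕ} (ha : 0 < a)
    (m b : ℕ) : ∏ l ∈ Finset.range ((m + 1) * a + b), f (min m (l / a)) =
      (∏ j ∈ Finset.range (m + 1), f j) ^ a * f m ^ b := by
  have hlow : ∀ l ∈ Finset.range ((m + 1) * a), f (min m (l / a)) = f (l / a) := fun l hl => by
    rw [min_eq_right (Nat.lt_succ_iff.1 (Nat.div_lt_of_lt_mul (by simpa [mul_comm] using hl)))]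
  have hhigh : ∀ i ∈ Finset.range b, f (min m (((m + 1) * a + i) / a)) = f m := fun i _ => by
    rw [mul_comm, Nat.mul_add_div ha, min_eq_left (m.le_succ.trans (Nat.le_add_right _ _))]
  rw [Finset.prod_range_add, Finset.prod_congr rfl hlow, prod_range_mul_comp_div f ha,
    Finset.prod_congr rfl hhigh, Finset.prod_const, Finset.card_range, Finset.prod_pow]

variable {K C : Type*} [Field K] [NormedField C] [Algebra K C] {E : Set (C × C)} {R : ℝ≥0}

theorem chebyshev_le_of_le_pow (hE : ∀ z ∈ E, ‖z‖₊ ≤ R) {m a b : ℕ} (ha : 0 < a) {t : ℕ → ℝ≥0∞}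
    (ht : ∀ j ≤ m, chebyshev K E (m * a) (j * a) ≤ t j ^ a) {l : ℕ} (hl : l ≤ (m + 1) * a + b) :
    chebyshev K E ((m + 1) * a + b) l ≤ t (min m (l / a)) ^ a * R ^ (a + b) := by
  obtain ⟨i, hi⟩ : ∃ i, l = min m (l / a) * a + i := Nat.exists_eq_add_of_le
    ((Nat.mul_le_mul_right a (min_le_right _ _)).trans (Nat.div_mul_le_self _ _))
  have hi' : i ≤ a + b := by
    rcases min_choice m (l / a) with hmin | hmin <;> rw [hmin] at hi
    · linarith
    · have := Nat.lt_div_mul_add (a := l) ha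
      omega
  conv_lhs => rw [hi, add_one_mul, add_assoc]
  refine (chebyshev_add_le_mul hE (Nat.mul_le_mul_right a (min_le_left _ _)) hi').trans ?_
  exact mul_le_mul' (ht _ (min_le_left _ _)) (chebyshev_le_pow hE hi')

theorem chebyshevProd_le_of_le_pow (hE : ∀ z ∈ E, ‖z‖₊ ≤ R) {m a : ℕ} (ha : 0 < a)
    {t : ℕ → ℝ≥0∞} (ht : ∀ j ≤ m, chebyshev K E (m * a) (j * a) ≤ t j ^ a) (b : ℕ) :
    chebyshevProd K E ((m + 1) * a + b) ≤
      ((∏ j ∈ Finset.range (m + 1), t j) ^ a * t m ^ (b + 1)) ^ a *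
        R ^ ((a + b) * ((m + 1) * a + b + 1)) := by
  calc chebyshevProd K E ((m + 1) * a + b)
      ≤ ∏ l ∈ Finset.range ((m + 1) * a + b + 1), t (min m (l / a)) ^ a * (R : ℝ≥0∞) ^ (a + b) :=
        Finset.prod_le_prod' fun l hl =>
          chebyshev_le_of_le_pow hE ha ht (Finset.mem_range_succ_iff.1 hl)
    _ = _ := by
        rw [Finset.prod_mul_distrib, Finset.prod_pow, Finset.prod_const, Finset.card_range,
          ← pow_mul, add_assoc, prod_range_min_comp_div t ha]

end BlockEstimate

section Descends

variable {K C : Type*} [Field K] [NormedField C] [Algebra K C] {E : Set (C × C)} {R : ℝ≥0}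

/-- Any bound on a Chebyshev constant of `E` over `C` holds over `K` after passing to a multiple of
the degree. This is all that the comparison of the two capacities uses about the field `K`. -/
def Descends (K : Type*) [Field K] [Algebra K C] (E : Set (C × C)) : Prop :=
  ∀ ⦃m j : ℕ⦄, j ≤ m → ∀ t : ℝ≥0∞, chebyshev C E m j < t →
    ∃ D, 0 < D ∧ chebyshev K E (m * D) (j * D) ≤ t ^ D

theorem Descends.exists_forall_chebyshev_le (hK : Descends K E) (hE : ∀ z ∈ E, ‖z‖₊ ≤ R) {m : ℕ}
    {t : ℕ → ℝ≥0∞} (ht : ∀ j ≤ m, chebyshev C E m j < t j) :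
    ∃ D, 0 < D ∧ ∀ q, ∀ j ≤ m, chebyshev K E (m * (q * D)) (j * (q * D)) ≤ t j ^ (q * D) := by
  choose! D hD hle using fun j hj => hK hj (t j) (ht j hj)
  refine ⟨∏ j ∈ Finset.range (m + 1), D j,
    Finset.prod_pos fun j hj => hD j (Finset.mem_range_succ_iff.1 hj), fun q j hj => ?_⟩
  obtain ⟨e, he⟩ := Finset.dvd_prod_of_mem D (Finset.mem_range_succ_iff.2 hj)
  rw [he, show q * (D j * e) = D j * (e * q) by ring, ← mul_assoc m, ← mul_assoc j, pow_mul]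
  exact (chebyshev_mul_le_pow hE (Nat.mul_le_mul_right _ hj) _).trans
    (pow_le_pow_left' (hle j hj) _)

theorem exists_chebyshev_lt_and_prod_lt (hE : ∀ z ∈ E, ‖z‖₊ ≤ R) {m : ℕ} {x : ℝ≥0∞}
    (hx : chebyshevProd C E m < x) : ∃ t : ℕ → ℝ≥0, (∀ j ≤ m, chebyshev C E m j < t j) ∧
      ∏ j ∈ Finset.range (m + 1), (t j : ℝ≥0∞) < x := by
  have hT : ∀ j ∈ Finset.range (m + 1), chebyshev C E m j ≠ ∞ := fun j hj =>
    chebyshev_ne_top hE (Finset.mem_range_succ_iff.1 hj)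
  obtain ⟨ε, hε, hε₀, hε'⟩ := (((tendsto_prod_add_nhdsGT_zero _ hT).eventually_lt_const hx).and
    (eventually_mem_nhdsWithin.and (eventually_nhdsWithin_of_eventually_nhds
      (gt_mem_nhds ENNReal.zero_lt_top)))).exists
  have hcoe : ∀ j ∈ Finset.range (m + 1),
      ((chebyshev C E m j + ε).toNNReal : ℝ≥0∞) = chebyshev C E m j + ε := fun j hj =>
    ENNReal.coe_toNNReal (ENNReal.add_ne_top.2 ⟨hT j hj, hε'.ne⟩)
  refine ⟨fun j => (chebyshev C E m j + ε).toNNReal, fun j hj => ?_, ?_⟩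
  · have hj' := Finset.mem_range_succ_iff.2 hj
    rw [hcoe j hj']
    exact ENNReal.lt_add_right (hT j hj') hε₀.ne'
  · rwa [Finset.prod_congr rfl hcoe]

end Descends

section Limit

theorem tendsto_block {m M : ℕ} {a b : ℕ → ℕ} (hab : ∀ n, (m + 1) * a n + b n = n)
    (hb : ∀ n, b n ≤ M) (S s ρ : ℝ) :
    Tendsto (fun n : ℕ => 2 / ((n : ℝ) + 1) ^ 2 *
        (a n * (a n * S + (b n + 1) * s) + (a n + b n) * (n + 1) * ρ)) atTop
      (𝓝 (2 / ((m : ℝ) + 1) ^ 2 * S + 2 * ρ / (m + 1))) := by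
  have h₀ : Tendsto (fun n : ℕ => 1 / ((n : ℝ) + 1)) atTop (𝓝 0) :=
    tendsto_one_div_add_atTop_nhds_zero_nat
  have hβ : Tendsto (fun n : ℕ => b n * (1 / ((n : ℝ) + 1))) atTop (𝓝 0) :=
    squeeze_zero (fun n => by positivity)
      (fun n => mul_le_mul_of_nonneg_right (Nat.cast_le.2 (hb n)) (by positivity))
      (by simpa using h₀.const_mul (M : ℝ))
  have hα : Tendsto (fun n : ℕ => a n * (1 / ((n : ℝ) + 1))) atTop (𝓝 (1 / (m + 1))) := by
    have ha (n : ℕ) : a n * (1 / ((n : ℝ) + 1)) =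
        (1 - b n * (1 / ((n : ℝ) + 1)) - 1 / ((n : ℝ) + 1)) / (m + 1) := by
      have : ((m : ℝ) + 1) * a n + b n = n := mod_cast hab n
      field_simp
      linarith
    simp only [ha]
    simpa using ((hβ.const_sub 1).sub h₀).div_const ((m : ℝ) + 1)
  have hlim := (((hα.mul ((hα.mul_const S).add ((hβ.add h₀).mul_const s))).add
    ((hα.add hβ).mul_const ρ))).const_mul 2
  refine (hlim.congr fun n => ?_).trans_eq ?_
  · field_simp
  · congr 1
    field_simp
    ring

variable {K C : Type*} [Field K] [NormedField C] [Algebra K C] {E : Set (C × C)} {R : ℝ≥0}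

theorem Descends.limsup_scaledLog_le_of_chebyshev_lt (hK : Descends K E)
    (hE : ∀ z ∈ E, ‖z‖₊ ≤ R) (hR : R ≠ 0) {m : ℕ} {t : ℕ → ℝ≥0}
    (ht : ∀ j ≤ m, chebyshev C E m j < t j) :
    limsup (fun n => scaledLog n (chebyshevProd K E n)) atTop ≤
      scaledLog m (∏ j ∈ Finset.range (m + 1), (t j : ℝ≥0∞)) +
        ((2 * Real.log R / (m + 1) : ℝ) : EReal) := by
  obtain ⟨D, hD, hD'⟩ := hK.exists_forall_chebyshev_le hE ht
  have ht₀ : ∀ j ≤ m, t j ≠ 0 := fun j hj => ENNReal.coe_ne_zero.1 (pos_of_gt (ht j hj)).ne'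
  set T : ℝ≥0 := ∏ j ∈ Finset.range (m + 1), t j with hT
  have hT₀ : T ≠ 0 := Finset.prod_ne_zero_iff.2 fun j hj => ht₀ j (Finset.mem_range_succ_iff.1 hj)
  set a : ℕ → ℕ := fun n => n / ((m + 1) * D) * D with ha
  set b : ℕ → ℕ := fun n => n % ((m + 1) * D) with hb
  have hab (n : ℕ) : (m + 1) * a n + b n = n := by
    rw [ha, hb, mul_comm, mul_assoc, mul_comm D, Nat.div_add_mod']
  have hlim := EReal.tendsto_coe.2 (tendsto_block hab (M := (m + 1) * D)
    (fun n => (Nat.mod_lt n (by positivity)).le) (Real.log T) (Real.log (t m)) (Real.log R))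
  rw [EReal.coe_add, ← scaledLog_coe m hT₀, hT, ENNReal.ofNNReal_finsetProd] at hlim
  rw [← hlim.limsup_eq]
  refine limsup_le_limsup ?_
  filter_upwards [eventually_ge_atTop ((m + 1) * D)] with n hn
  have ha₀ : 0 < a n := Nat.mul_pos (Nat.div_pos hn (by positivity)) hD
  have hblock := scaledLog_mono n (chebyshevProd_le_of_le_pow hE ha₀ (hD' _) (b n))
  rw [hab] at hblock
  refine hblock.trans_eq ?_
  rw [← ENNReal.ofNNReal_finsetProd, ← hT]
  simp only [← ENNReal.coe_pow, ← ENNReal.coe_mul]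
  rw [scaledLog_coe n (by simp [hT₀, ht₀ m le_rfl, hR])]
  congr 2
  push_cast
  rw [Real.log_mul (by simp [hT₀, ht₀ m le_rfl]) (by simp [hR]), Real.log_pow,
    Real.log_mul (by simp [hT₀]) (by simp [ht₀ m le_rfl])]
  simp only [Real.log_pow]
  push_cast
  ring

theorem Descends.limsup_scaledLog_chebyshevProd_le (hK : Descends K E) (hE : ∀ z ∈ E, ‖z‖₊ ≤ R)
    (hR : R ≠ 0) (m : ℕ) : limsup (fun n => scaledLog n (chebyshevProd K E n)) atTop ≤
      scaledLog m (chebyshevProd C E m) + ((2 * Real.log R / (m + 1) : ℝ) : EReal) := by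
  rw [← EReal.sub_le_iff_le_add (.inl (EReal.coe_ne_bot _)) (.inl (EReal.coe_ne_top _))]
  have : (𝓝[>] chebyshevProd C E m).NeBot :=
    nhdsGT_neBot_of_exists_gt ⟨∞, (chebyshevProd_ne_top hE m).lt_top⟩
  have hlim : Tendsto (scaledLog m) (𝓝[>] chebyshevProd C E m) _ :=
    (continuous_scaledLog m).continuousWithinAt
  refine ge_of_tendsto hlim (eventually_mem_nhdsWithin.mono fun x hx => EReal.sub_le_of_le_add ?_)
  obtain ⟨t, ht, htx⟩ := exists_chebyshev_lt_and_prod_lt hE hx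
  exact (hK.limsup_scaledLog_le_of_chebyshev_lt hE hR ht).trans
    (add_le_add_left (scaledLog_mono m htx.le) _)

theorem tendsto_ereal_add_zero {α : Type*} {f : Filter α} {u e : α → EReal} {L : EReal}
    (hu : Tendsto u f (𝓝 L)) (he : Tendsto e f (𝓝 0)) :
    Tendsto (fun n => u n + e n) f (𝓝 L) := by
  simpa [Function.comp_def] using
    (EReal.continuousAt_add (p := (L, 0)) (by simp) (by simp)).tendsto.comp (hu.prodMk_nhds he)

theorem scaledLog_maxDet_le (hE : ∀ z ∈ E, ‖z‖₊ ≤ R) (n : ℕ) : scaledLog n (maxDet E n (n + 1)) ≤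
    scaledLog n (((n + 1 : ℕ) : ℝ≥0∞) ^ (n + 1)) + scaledLog n (chebyshevProd K E n) := by
  rw [← scaledLog_mul]
  refine scaledLog_mono n ((maxDet_le_factorial_mul_chebyshevProd (K := K) hE n).trans ?_)
  gcongr
  exact_mod_cast Nat.factorial_le_pow (n + 1)

theorem scaledLog_chebyshevProd_le (hne : E.Nonempty) (n : ℕ) :
    scaledLog n (chebyshevProd C E n) ≤ scaledLog n (maxDet E n (n + 1)) :=
  scaledLog_mono n (prod_chebyshev_le_maxDet hne n (n + 1))

theorem Descends.exists_tendsto_scaledLog (hK : Descends K E) (hne : E.Nonempty)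
    (hE : ∀ z ∈ E, ‖z‖₊ ≤ R) (hR : R ≠ 0) : ∃ L : EReal, L ≠ ⊤ ∧
      Tendsto (fun n => scaledLog n (chebyshevProd K E n)) atTop (𝓝 L) ∧
      Tendsto (fun n => scaledLog n (maxDet E n (n + 1))) atTop (𝓝 L) := by
  set L := limsup (fun n => scaledLog n (chebyshevProd K E n)) atTop
  have hlow (m : ℕ) : L - ((2 * Real.log R / (m + 1) : ℝ) : EReal) ≤
      scaledLog m (maxDet E m (m + 1)) :=
    EReal.sub_le_of_le_add ((hK.limsup_scaledLog_chebyshevProd_le hE hR m).trans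
      (add_le_add_left (scaledLog_chebyshevProd_le hne m) _))
  have hc : Tendsto (fun m : ℕ => -((2 * Real.log R / (m + 1) : ℝ) : EReal)) atTop (𝓝 0) := by
    have hreal := (tendsto_one_div_add_atTop_nhds_zero_nat (𝕜 := ℝ)).const_mul (-(2 * Real.log R))
    simpa [div_eq_mul_inv] using EReal.tendsto_coe.2 hreal
  have hlow_lim := tendsto_ereal_add_zero (tendsto_const_nhds (x := L)) hc
  have herr := tendsto_scaledLog_succ_pow_succ
  have hP : Tendsto (fun n => scaledLog n (chebyshevProd K E n)) atTop (𝓝 L) := by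
    refine tendsto_of_le_liminf_of_limsup_le ?_ le_rfl
    rw [← (tendsto_ereal_add_zero hlow_lim (neg_zero (G := EReal) ▸ herr.neg)).liminf_eq]
    exact liminf_le_liminf (.of_forall fun n =>
      EReal.sub_le_of_le_add' ((hlow n).trans (scaledLog_maxDet_le hE n)))
  refine ⟨L, ne_top_of_le_ne_top ?_ (hK.limsup_scaledLog_chebyshevProd_le hE hR 0), hP, ?_⟩
  · exact EReal.add_ne_top (scaledLog_ne_top 0 (chebyshevProd_ne_top hE 0)) (EReal.coe_ne_top _)
  · refine tendsto_of_tendsto_of_tendsto_of_le_of_le hlow_lim (tendsto_ereal_add_zero hP herr)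
      hlow fun n => ?_
    exact (scaledLog_maxDet_le (K := K) hE n).trans_eq (add_comm _ _)

end Limit

section Capacity

theorem tendsto_ereal_coe_mul {α : Type*} {f : Filter α} {c : α → ℝ} {c₀ : ℝ} {u : α → EReal}
    {L : EReal} (hc : Tendsto c f (𝓝 c₀)) (hc₀ : c₀ ≠ 0) (hu : Tendsto u f (𝓝 L)) :
    Tendsto (fun n => (c n : EReal) * u n) f (𝓝 (c₀ * L)) :=
  EReal.Tendsto.mul (EReal.tendsto_coe.2 hc) hu (.inl (EReal.coe_ne_zero.2 hc₀))
    (.inl (EReal.coe_ne_zero.2 hc₀)) (.inl (EReal.coe_ne_bot _)) (.inl (EReal.coe_ne_top _))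

theorem tendsto_one_add_one_div : Tendsto (fun n : ℕ => 1 + 1 / (n : ℝ)) atTop (𝓝 1) := by
  simpa using tendsto_one_div_atTop_nhds_zero_nat.const_add (1 : ℝ)

section Diameter

variable {C : Type*} [NormedField C] (E : Set (C × C)) {δ : ℕ}

theorem homDiameter_succ (hδ : δ ≠ 0) {n : ℕ} (hn : n ≠ 0) :
    homDiameter (fun z : C => ‖z‖ ^ δ) E (n + 1) =
      maxDet E n (n + 1) ^ (δ * (2 / (n * (n + 1))) : ℝ) := by
  have hexp : 0 < (δ * (2 / (n * (n + 1))) : ℝ) := by positivity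
  rw [maxDet, ← ENNReal.orderIsoRpow_apply _ hexp, OrderIso.map_iSup]
  refine iSup_congr fun z => ?_
  have hwedge := prod_enorm_wedge n fun i => (z i : C × C)
  simp only [ENNReal.ofReal_pow (norm_nonneg _), ofReal_norm, Finset.prod_pow, hwedge,
    ENNReal.orderIsoRpow_apply]
  rw [← pow_mul, ← ENNReal.rpow_natCast, ← ENNReal.rpow_mul]
  congr 1
  push_cast
  rw [add_sub_cancel_right]
  field_simp

theorem log_homDiameter_succ (hδ : δ ≠ 0) {n : ℕ} (hn : n ≠ 0) :
    ENNReal.log (homDiameter (fun z : C => ‖z‖ ^ δ) E (n + 1)) =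
      ((δ * (1 + 1 / n) : ℝ) : EReal) * scaledLog n (maxDet E n (n + 1)) := by
  rw [homDiameter_succ E hδ hn, ENNReal.log_rpow, scaledLog, ← mul_assoc, ← EReal.coe_mul]
  congr 2
  field_simp

theorem tendsto_homDiameter (hδ : δ ≠ 0) {L : EReal}
    (hL : Tendsto (fun n => scaledLog n (maxDet E n (n + 1))) atTop (𝓝 L)) :
    Tendsto (homDiameter (fun z : C => ‖z‖ ^ δ) E) atTop (𝓝 (EReal.exp (δ * L))) := by
  rw [← tendsto_add_atTop_iff_nat 1]
  have hcoeff : Tendsto (fun n : ℕ => (δ : ℝ) * (1 + 1 / n)) atTop (𝓝 (δ : ℝ)) := by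
    simpa using tendsto_one_add_one_div.const_mul (δ : ℝ)
  refine ((ENNReal.continuous_exp.tendsto _).comp
    (tendsto_ereal_coe_mul hcoeff (Nat.cast_ne_zero.2 hδ) hL)).congr' ?_
  filter_upwards [eventually_ne_atTop 0] with n hn
  rw [Function.comp_apply, ← log_homDiameter_succ E hδ hn, ENNReal.exp_log]

end Diameter

section Volume

/-- Closed balls of radius `r > 0` have measure comparable to `r ^ δ`, uniformly in the centre and
the radius. -/
def AhlforsRegular {X : Type*} [PseudoMetricSpace X] [MeasurableSpace X] (μ : Measure X) (δ : ℕ) :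
    Prop :=
  ∃ A B : ℝ≥0, A ≠ 0 ∧ B ≠ 0 ∧ ∀ x, ∀ r : ℝ≥0, r ≠ 0 →
    B * r ^ δ ≤ μ (Metric.closedBall x r) ∧ μ (Metric.closedBall x r) ≤ A * r ^ δ

theorem AhlforsRegular.isLocallyFiniteMeasure {X : Type*} [PseudoMetricSpace X] [MeasurableSpace X]
    {μ : Measure X} {δ : ℕ} (hμ : AhlforsRegular μ δ) : IsLocallyFiniteMeasure μ := by
  obtain ⟨A, B, -, -, hball⟩ := hμ
  refine ⟨fun x => ⟨_, Metric.closedBall_mem_nhds x one_pos, ?_⟩⟩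
  exact (hball x 1 one_ne_zero).2.trans_lt (by simp)

theorem logVolume_eq_mul_scaledLog {K C : Type*} [Field K] [Field C] [Algebra K C]
    [MeasurableSpace K] (vol : Measure K) (abv : C → ℝ) (E : Set (C × C)) {n : ℕ} (hn : n ≠ 0) :
    logVolume vol abv E n =
      (((1 + 1 / n) ^ 2 : ℝ) : EReal) * scaledLog n (formVolume vol n (unitForms K abv E n)) := by
  rw [logVolume, scaledLog, ← mul_assoc, ← EReal.coe_mul]
  congr 2
  field_simp

variable {K C : Type*} [NormedField K] [NormedField C] [NormedAlgebra K C] [MeasurableSpace K]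
  [BorelSpace K] [SecondCountableTopology K] {vol : Measure K} {E : Set (C × C)} {R : ℝ≥0} {δ : ℕ}

theorem tendsto_scaledLog_formVolume (hvol : AhlforsRegular vol δ) (hE : ∀ z ∈ E, ‖z‖₊ ≤ R)
    (hδ : δ ≠ 0) {L : EReal}
    (hL : Tendsto (fun n => scaledLog n (chebyshevProd K E n)) atTop (𝓝 L)) :
    Tendsto (fun n => scaledLog n (formVolume vol n (unitForms K (fun z : C => ‖z‖ ^ δ) E n)))
      atTop (𝓝 (-(δ * L))) := by
  have := hvol.isLocallyFiniteMeasure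
  obtain ⟨A, B, hA, hB, hball⟩ := hvol
  have hmul {u : ℕ → EReal} (hu : Tendsto u atTop (𝓝 L)) :
      Tendsto (fun n => -((δ : EReal) * u n)) atTop (𝓝 (-(δ * L))) :=
    (EReal.Tendsto.const_mul hu (.inl (EReal.natCast_ne_bot δ))
      (.inl (EReal.natCast_ne_top δ))).neg
  have hlow := tendsto_ereal_add_zero
    (hmul (tendsto_ereal_add_zero hL tendsto_scaledLog_succ_pow_succ))
    (tendsto_scaledLog_pow_succ hB)
  have hupp := tendsto_ereal_add_zero (hmul hL)
    (tendsto_scaledLog_pow_succ (mul_ne_zero hA (pow_ne_zero δ two_ne_zero)))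
  refine tendsto_of_tendsto_of_tendsto_of_le_of_le hlow hupp (fun n => ?_) fun n => ?_
  · refine le_trans (le_of_eq ?_) (scaledLog_mono n
      (div_chebyshevProd_le_formVolume hE hδ (fun x r hr => (hball x r hr).1) n))
    rw [div_eq_mul_inv, scaledLog_mul, scaledLog_inv, scaledLog_pow n (_ * _), scaledLog_mul,
      add_comm, add_comm (scaledLog n (chebyshevProd K E n))]
  · refine (scaledLog_mono n (formVolume_le_div_chebyshevProd hE hδ (ENNReal.coe_ne_zero.2 hA)
      (fun x r hr => (hball x r hr).2) n)).trans (le_of_eq ?_)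
    rw [div_eq_mul_inv, scaledLog_mul, scaledLog_inv, scaledLog_pow n (chebyshevProd K E n),
      add_comm]
    push_cast
    rfl

theorem tendsto_logVolume (hvol : AhlforsRegular vol δ) (hE : ∀ z ∈ E, ‖z‖₊ ≤ R)
    (hδ : δ ≠ 0) {L : EReal}
    (hL : Tendsto (fun n => scaledLog n (chebyshevProd K E n)) atTop (𝓝 L)) :
    Tendsto (logVolume vol (fun z : C => ‖z‖ ^ δ) E) atTop (𝓝 (-(δ * L))) := by
  have hcoeff : Tendsto (fun n : ℕ => (1 + 1 / (n : ℝ)) ^ 2) atTop (𝓝 1) := by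
    simpa using tendsto_one_add_one_div.pow 2
  have hlim := tendsto_ereal_coe_mul hcoeff one_ne_zero (tendsto_scaledLog_formVolume hvol hE hδ hL)
  rw [EReal.coe_one, one_mul] at hlim
  refine hlim.congr' ?_
  filter_upwards [eventually_ne_atTop 0] with n hn
  rw [logVolume_eq_mul_scaledLog vol _ E hn]

end Volume

theorem Descends.homSectionalCapacity_eq {K C : Type*} [NormedField K] [NormedField C]
    [NormedAlgebra K C] [MeasurableSpace K] [BorelSpace K] [SecondCountableTopology K]
    {vol : Measure K} {E : Set (C × C)} {δ : ℕ} {abv : C → ℝ} (hK : Descends K E)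
    (hne : E.Nonempty) (hbdd : Bornology.IsBounded E) (hδ : δ ≠ 0) (hvol : AhlforsRegular vol δ)
    (habv : ∀ z, abv z = ‖z‖ ^ δ) :
    Tendsto (homDiameter abv E) atTop (𝓝 (homTransfiniteDiameter abv E)) ∧
      Tendsto (logVolume vol abv E) atTop
        (𝓝 (-ENNReal.log (homSectionalCapacity vol abv E))) ∧
      homTransfiniteDiameter abv E ≠ ∞ ∧
      homSectionalCapacity vol abv E = homTransfiniteDiameter abv E := by
  obtain rfl : abv = fun z => ‖z‖ ^ δ := funext habv
  obtain ⟨R, hR, hE⟩ := hbdd.exists_pos_norm_le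
  lift R to ℝ≥0 using hR.le
  obtain ⟨L, hL, hcheb, hdet⟩ := hK.exists_tendsto_scaledLog hne hE (NNReal.coe_pos.1 hR).ne'
  have hdiam := tendsto_homDiameter E hδ hdet
  have hlogVol := tendsto_logVolume hvol hE hδ hcheb
  have hδL : (δ : EReal) * L ≠ ⊤ := by
    have hδ₀ : (0 : EReal) ≤ δ := Nat.cast_nonneg' δ
    exact (EReal.mul_ne_top _ _).2 ⟨.inl (EReal.natCast_ne_bot δ), .inl hδ₀,
      .inl (EReal.natCast_ne_top δ), .inr hL⟩
  have hdiam_eq : homTransfiniteDiameter (fun z : C => ‖z‖ ^ δ) E = EReal.exp (δ * L) :=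
    hdiam.limUnder_eq
  have hcap_eq : homSectionalCapacity vol (fun z : C => ‖z‖ ^ δ) E = EReal.exp (δ * L) := by
    rw [homSectionalCapacity, hlogVol.limUnder_eq, neg_neg]
  rw [hdiam_eq, hcap_eq, EReal.log_exp]
  exact ⟨hdiam, hlogVol, EReal.exp_eq_top_iff.not.2 hδL, rfl⟩

end Capacity

section Descent

open Polynomial

section Density

variable {C : Type*} [NormedField C] {E : Set (C × C)} {R : ℝ≥0}

theorem formNorm_le_of_enorm_coeff_le (hE : ∀ z ∈ E, ‖z‖₊ ≤ R) {n : ℕ} {p : C[X]}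
    (hp : p.natDegree ≤ n) {ε : ℝ≥0∞} (hε : ∀ i, ‖p.coeff i‖ₑ ≤ ε) :
    formNorm E n p ≤ ε * ((n + 1 : ℕ) * R ^ n) := by
  calc formNorm E n p
      = formNorm E n (∑ i ∈ Finset.range (n + 1), Polynomial.C (p.coeff i) * X ^ i) := by
        rw [← as_sum_range_C_mul_X_pow' _ (Nat.lt_succ_of_le hp)]
    _ ≤ ∑ i ∈ Finset.range (n + 1), ‖p.coeff i‖ₑ * formNorm E n (X ^ i) :=
        (formNorm_sum_le _ _ _).trans_eq (by simp only [formNorm_C_mul])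
    _ ≤ ∑ _i ∈ Finset.range (n + 1), ε * R ^ n := by
        gcongr with i hi
        · exact hε i
        · exact formNorm_X_pow_le hE (Finset.mem_range_succ_iff.1 hi)
    _ = ε * ((n + 1 : ℕ) * R ^ n) := by
        rw [Finset.sum_const, Finset.card_range, nsmul_eq_mul, mul_left_comm]

theorem chebyshev_le_of_denseRange {F : Type*} [Field F] [Algebra F C]
    (hF : DenseRange (algebraMap F C)) (hE : ∀ z ∈ E, ‖z‖₊ ≤ R) {n l : ℕ} (hl : l ≤ n) :
    chebyshev F E n l ≤ chebyshev C E n l := by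
  refine le_of_forall_gt fun t ht => ?_
  obtain ⟨p, hp, hpt⟩ := exists_formNorm_lt_of_chebyshev_lt ht
  rw [Algebra.algebraMap_self, Polynomial.map_id] at hpt
  obtain ⟨ε, hε, hεt⟩ := ENNReal.exists_nnreal_pos_mul_lt (a := (n + 1 : ℕ) * (R : ℝ≥0∞) ^ n)
    (by finiteness) (tsub_pos_of_lt hpt).ne'
  obtain ⟨q, hq, hqp, hcoeff⟩ :=
    exists_monic_and_natDegree_eq_and_norm_map_algebraMap_coeff_sub_lt hF hp.monic
      (NNReal.coe_pos.2 hε)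
  have hql : q.IsMonicOfDegree l := ⟨hqp ▸ hp.natDegree_eq, hq⟩
  set q' := q.map (algebraMap F C)
  have hdeg : (q' - p).natDegree ≤ n := (natDegree_sub_le _ _).trans <|
    max_le ((isMonicOfDegree_map hql).natDegree_eq.trans_le hl) (hp.natDegree_eq.trans_le hl)
  have hdiff : formNorm E n (q' - p) ≤ ε * ((n + 1 : ℕ) * R ^ n) :=
    formNorm_le_of_enorm_coeff_le hE hdeg fun i => by
      rw [coeff_sub]
      exact mod_cast (hcoeff i).le
  calc chebyshev F E n l ≤ formNorm E n q' := chebyshev_le_formNorm hql n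
    _ ≤ formNorm E n p + formNorm E n (q' - p) := by simpa using formNorm_add_le n p (q' - p)
    _ < t := (add_le_add_right hdiff _).trans_lt (add_comm (formNorm E n p) _ ▸
        lt_tsub_iff_right.1 hεt)

end Density

section GaloisDescent

variable {K F : Type*} [Field K] [Field F] [Algebra K F] [IsGalois K F]

theorem exists_monic_map_eq_prod_map [FiniteDimensional K F] {p : F[X]} (hp : p.Monic) :
    ∃ q : K[X], q.Monic ∧ q.map (algebraMap K F) = ∏ σ : F ≃ₐ[K] F, p.map (σ : F →+* F) := by
  set N : F[X] := ∏ σ : F ≃ₐ[K] F, p.map (σ : F →+* F) with hN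
  have hfixed (τ : F ≃ₐ[K] F) : N.map (τ : F →+* F) = N := by
    rw [hN, Polynomial.map_prod]
    refine Fintype.prod_equiv (Equiv.mulLeft τ) _ _ fun σ => ?_
    rw [Polynomial.map_map]
    rfl
  have hcoeff (i : ℕ) : N.coeff i ∈ Set.range (algebraMap K F) :=
    (IsGalois.mem_range_algebraMap_iff_fixed _).2 fun τ => by
      conv_rhs => rw [← hfixed τ, coeff_map]
      rfl
  obtain ⟨q, hqN, -, hq⟩ := lifts_and_natDegree_eq_and_monic ((lifts_iff_coeff_lifts N).2 hcoeff)
    (monic_prod_of_monic _ _ fun σ _ => hp.map _)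
  exact ⟨q, hq, hqN⟩

theorem exists_finset_monic_map_eq_prod_map {p : F[X]} (hp : p.Monic) :
    ∃ s : Finset (F ≃ₐ[K] F), s.Nonempty ∧
      ∃ q : K[X], q.Monic ∧ q.map (algebraMap K F) = ∏ σ ∈ s, p.map (σ : F →+* F) := by
  let L := FiniteGaloisIntermediateField.adjoin K (p.coeffs : Set F)
  have hcoeff (i : ℕ) : p.coeff i ∈ Set.range (algebraMap L F) := by
    rcases eq_or_ne (p.coeff i) 0 with h | h
    · exact ⟨0, by rw [h, map_zero]⟩
    · exact ⟨⟨p.coeff i, FiniteGaloisIntermediateField.subset_adjoin _ _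
        (coeff_mem_coeffs h)⟩, rfl⟩
  obtain ⟨p', hp', -, hmonic⟩ :=
    lifts_and_natDegree_eq_and_monic ((lifts_iff_coeff_lifts p).2 hcoeff) hp
  obtain ⟨q, hq, hqp⟩ := exists_monic_map_eq_prod_map (K := K) hmonic
  have hinj : Function.Injective fun σ : L ≃ₐ[K] L => σ.liftNormal F :=
    Function.LeftInverse.injective (g := fun σ => σ.restrictNormal L) fun σ =>
      σ.restrict_liftNormal F
  refine ⟨Finset.univ.map ⟨_, hinj⟩, Finset.univ_nonempty.map, q, hq, ?_⟩
  rw [IsScalarTower.algebraMap_eq K L F, ← Polynomial.map_map, hqp, Polynomial.map_prod,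
    Finset.prod_map]
  refine Finset.prod_congr rfl fun σ _ => ?_
  rw [← hp', Polynomial.map_map, Polynomial.map_map]
  congr 1
  ext x
  exact (σ.liftNormal_commutes F x).symm

end GaloisDescent

variable {K C : Type*} [Field K] [NormedField C] [Algebra K C] {E : Set (C × C)}

theorem GaloisStable.formNorm_map_le (hE : GaloisStable K E) (σ : C ≃ₐ[K] C) (hσ : Isometry σ)
    (n : ℕ) (p : C[X]) : formNorm E n (p.map (σ : C →+* C)) ≤ formNorm E n p :=
  formNorm_le_iff.2 fun z hz => by
    have heval : formEval n z (p.map (σ : C →+* C)) =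
        σ (formEval n (σ.symm z.1, σ.symm z.2) p) := by
      simpa using formEval_map (σ : C →+* C) n p (σ.symm z.1, σ.symm z.2)
    have hσ' : Isometry σ.symm := hσ.right_inv σ.apply_symm_apply
    rw [heval, enorm_eq_iff_norm_eq.2 (hσ.norm_map_of_map_zero (map_zero σ) _)]
    exact enorm_formEval_le (hE ⟨σ.symm, hσ'.continuous, hσ.continuous⟩ z hz) n p

theorem GaloisStable.formNorm_map_conj_le {F : Type*} [Field F] [Algebra K F] [Algebra F C]
    (hE : GaloisStable K E) {σ : F ≃ₐ[K] F} {τ : C ≃ₐ[K] C} (hτ : Isometry τ)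
    (hτσ : ∀ x, τ (algebraMap F C x) = algebraMap F C (σ x)) (n : ℕ) (p : F[X]) :
    formNorm E n ((p.map (σ : F →+* F)).map (algebraMap F C)) ≤
      formNorm E n (p.map (algebraMap F C)) := by
  have hmap : (p.map (σ : F →+* F)).map (algebraMap F C) =
      (p.map (algebraMap F C)).map (τ : C →+* C) := by
    rw [Polynomial.map_map, Polynomial.map_map]
    congr 1
    ext x
    exact (hτσ x).symm
  rw [hmap]
  exact hE.formNorm_map_le τ hτ n _

theorem GaloisStable.descends {F : Type*} [Field F] [Algebra K F] [Algebra F C]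
    [IsScalarTower K F C] [IsGalois K F] (hE : GaloisStable K E)
    (hbdd : Bornology.IsBounded E) (hF : DenseRange (algebraMap F C))
    (hext : ∀ σ : F ≃ₐ[K] F, ∃ τ : C ≃ₐ[K] C, Isometry τ ∧
      ∀ x, τ (algebraMap F C x) = algebraMap F C (σ x)) :
    Descends K E := by
  obtain ⟨R, hR, hER⟩ := hbdd.exists_pos_norm_le
  lift R to ℝ≥0 using hR.le
  intro n l hl t ht
  obtain ⟨p, hp, hpt⟩ :=
    exists_formNorm_lt_of_chebyshev_lt ((chebyshev_le_of_denseRange hF hER hl).trans_lt ht)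
  obtain ⟨s, hs, q, hq, hqp⟩ := exists_finset_monic_map_eq_prod_map (K := K) hp.monic
  have hdeg (σ : F ≃ₐ[K] F) : (p.map (σ : F →+* F)).natDegree = l := by
    rw [natDegree_map, hp.natDegree_eq]
  have hql : q.IsMonicOfDegree (l * s.card) := by
    refine ⟨?_, hq⟩
    rw [← natDegree_map (algebraMap K F), hqp,
      natDegree_prod_of_monic _ _ fun σ _ => hp.monic.map _,
      Finset.sum_congr rfl fun σ _ => hdeg σ, Finset.sum_const, smul_eq_mul, mul_comm]
  have hconj (σ : F ≃ₐ[K] F) :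
      formNorm E n ((p.map (σ : F →+* F)).map (algebraMap F C)) ≤ t := by
    obtain ⟨τ, hτ, hτσ⟩ := hext σ
    exact (hE.formNorm_map_conj_le hτ hτσ n p).trans hpt.le
  refine ⟨s.card, hs.card_pos, (chebyshev_le_formNorm hql _).trans ?_⟩
  rw [IsScalarTower.algebraMap_eq K F C, ← Polynomial.map_map, hqp, Polynomial.map_prod]
  calc formNorm E (n * s.card) (∏ σ ∈ s, (p.map (σ : F →+* F)).map (algebraMap F C))
      ≤ ∏ σ ∈ s, formNorm E n ((p.map (σ : F →+* F)).map (algebraMap F C)) := by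
        simpa [mul_comm] using formNorm_prod_le s (n := fun _ => n)
          fun σ _ => (natDegree_map _).trans_le ((hdeg σ).trans_le hl)
    _ ≤ t ^ s.card := Finset.prod_le_pow_card _ _ _ fun σ _ => hconj σ

end Descent

section Archimedean

variable {k : Type*} [Field k] (w : InfinitePlace k)

instance archNormedAlgebra : NormedAlgebra w.Completion ℂ where
  __ := archAlgebra w
  norm_smul_le x z := by
    rw [Algebra.smul_def, norm_mul]
    gcongr
    exact ((InfinitePlace.Completion.isometry_extensionEmbedding w).norm_map_of_map_zero
      (map_zero _) x).le

instance archSecondCountableTopology : SecondCountableTopology w.Completion :=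
  (InfinitePlace.Completion.isometry_extensionEmbedding w).isEmbedding.secondCountableTopology

theorem ofReal_mem_range_algebraMap_completion (x : ℝ) :
    (x : ℂ) ∈ Set.range (algebraMap w.Completion ℂ) := by
  rcases w.isReal_or_isComplex with hw | hw
  · obtain ⟨y, rfl⟩ := InfinitePlace.Completion.surjective_extensionEmbeddingOfIsReal hw x
    exact ⟨y, (InfinitePlace.Completion.extensionEmbeddingOfIsReal_apply hw y).symm⟩
  · exact InfinitePlace.Completion.surjective_extensionEmbedding_of_isComplex hw x

theorem isometry_algEquiv_complex (σ : ℂ ≃ₐ[w.Completion] ℂ) : Isometry σ := by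
  have hreal (x : ℝ) : σ x = x := by
    obtain ⟨y, hy⟩ := ofReal_mem_range_algebraMap_completion w x
    rw [← hy, σ.commutes]
  let σ' : ℂ →ₐ[ℝ] ℂ := { (σ : ℂ →+* ℂ) with commutes' := hreal }
  rcases Complex.real_algHom_eq_id_or_conj σ' with h | h
  · exact (congrArg DFunLike.coe h : ⇑σ = id) ▸ isometry_id
  · exact (congrArg DFunLike.coe h : ⇑σ = Complex.conjAe) ▸ Complex.isometry_conj

instance isGalois_completion_complex : IsGalois w.Completion ℂ := by
  have : CharZero w.Completion := (algebraMap w.Completion ℂ).charZero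
  have hI : IsIntegral w.Completion Complex.I :=
    .of_pow two_pos (Complex.I_sq ▸ isIntegral_one.neg)
  have hreal (x : ℝ) : IsIntegral w.Completion (x : ℂ) := by
    obtain ⟨y, hy⟩ := ofReal_mem_range_algebraMap_completion w x
    exact hy ▸ isIntegral_algebraMap
  have : Algebra.IsIntegral w.Completion ℂ :=
    ⟨fun z => z.re_add_im ▸ (hreal z.re).add ((hreal z.im).mul hI)⟩
  have : IsAlgClosure w.Completion ℂ := ⟨inferInstance, inferInstance⟩
  have := IsAlgClosure.normal w.Completion ℂ
  exact {}

theorem ahlforsRegular_archVol : AhlforsRegular (archVol w) w.mult := by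
  by_cases hw : w.IsReal
  · refine ⟨2, 2, two_ne_zero, two_ne_zero, fun x r _ => ?_⟩
    set e := InfinitePlace.Completion.isometryEquivRealOfIsReal hw
    have hball : archVol w (Metric.closedBall x r) = (2 : ℝ≥0) * r ^ w.mult := by
      rw [archVol, dif_pos hw,
        Measure.map_apply e.symm.continuous.measurable Metric.isClosed_closedBall.measurableSet,
        e.symm.preimage_closedBall, Real.volume_closedBall, hw.mult_eq_one, pow_one,
        ENNReal.ofReal_mul two_pos.le]
      simp
    exact ⟨hball.ge, hball.le⟩
  · have hw' := InfinitePlace.not_isReal_iff_isComplex.1 hw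
    refine ⟨NNReal.pi, NNReal.pi, NNReal.pi_ne_zero, NNReal.pi_ne_zero, fun x r _ => ?_⟩
    set e := InfinitePlace.Completion.isometryEquivComplexOfIsComplex hw'
    have hball : archVol w (Metric.closedBall x r) = NNReal.pi * r ^ w.mult := by
      rw [archVol, dif_neg hw,
        Measure.map_apply e.symm.continuous.measurable Metric.isClosed_closedBall.measurableSet,
        e.symm.preimage_closedBall, Complex.volume_closedBall, hw'.mult_eq_two, mul_comm,
        ENNReal.ofReal_coe_nnreal]
    exact ⟨hball.ge, hball.le⟩

theorem GaloisStable.descends_arch {E : Set (ℂ × ℂ)} (hE : GaloisStable w.Completion E)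
    (hbdd : Bornology.IsBounded E) : Descends w.Completion E :=
  hE.descends (F := ℂ) hbdd denseRange_id fun σ => ⟨σ, isometry_algEquiv_complex w σ, fun _ => rfl⟩

end Archimedean

section Completion

variable {K F : Type*} [NormedField K] [NormedField F] [NormedAlgebra K F]

theorem exists_isometry_completion_extending (σ : F ≃ₐ[K] F) (hσ : Isometry σ) :
    ∃ τ : UniformSpace.Completion F ≃ₐ[K] UniformSpace.Completion F,
      Isometry τ ∧ ∀ x : F, τ x = σ x := by
  have hσ' : Isometry σ.symm := hσ.right_inv σ.apply_symm_apply
  let τ := UniformSpace.Completion.mapRingEquiv (σ : F ≃+* F) hσ.continuous hσ'.continuous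
  have hτ (x : F) : τ x = σ x :=
    UniformSpace.Completion.mapRingHom_coe (f := (σ : F →+* F)) hσ.continuous x
  refine ⟨.ofRingEquiv (f := τ) fun x => ?_, hσ.completion_map, hτ⟩
  rw [UniformSpace.Completion.algebraMap_def, hτ, σ.commutes]

end Completion

section Nonarchimedean

variable {k : Type*} [Field k] [NumberField k] (v : HeightOneSpectrum (𝓞 k))

instance isGalois_adicAlgCl : IsGalois (v.adicCompletion k) (AdicAlgCl v) := by
  have : CharZero (v.adicCompletion k) :=
    charZero_of_injective_algebraMap (algebraMap k (v.adicCompletion k)).injective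
  infer_instance

theorem GaloisStable.descends_adic {E : Set (AdicComplex v × AdicComplex v)}
    (hE : GaloisStable (v.adicCompletion k) E) (hbdd : Bornology.IsBounded E) :
    Descends (v.adicCompletion k) E :=
  hE.descends (F := AdicAlgCl v) hbdd UniformSpace.Completion.denseRange_coe fun σ =>
    exists_isometry_completion_extending σ <|
      AddMonoidHomClass.isometry_of_norm σ fun x => (spectralNorm_eq_of_equiv σ x).symm

theorem adic_exists_norm_eq_zpow (n : ℤ) :
    ∃ x : v.adicCompletion k, ‖x‖ = (Ideal.absNorm v.asIdeal : ℝ) ^ n := by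
  obtain ⟨x, hx⟩ := v.valuedAdicCompletion_surjective k (WithZero.exp n)
  refine ⟨x, ?_⟩
  rw [FinitePlace.norm_def, hx, WithZeroMulInt.toNNReal_neg_apply _ WithZero.exp_ne_zero]
  push_cast
  rfl

theorem adic_norm_eq_zpow {x : v.adicCompletion k} (hx : x ≠ 0) :
    ∃ n : ℤ, ‖x‖ = (Ideal.absNorm v.asIdeal : ℝ) ^ n := by
  have hval : Valued.v x ≠ 0 := (Valuation.ne_zero_iff _).2 hx
  refine ⟨(WithZero.unzero hval).toAdd, ?_⟩
  rw [FinitePlace.norm_def, WithZeroMulInt.toNNReal_neg_apply _ hval]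
  push_cast
  rfl

theorem adic_ball_zpow_add_one (n : ℤ) :
    Metric.ball (0 : v.adicCompletion k) ((Ideal.absNorm v.asIdeal : ℝ) ^ (n + 1)) =
      Metric.closedBall 0 ((Ideal.absNorm v.asIdeal : ℝ) ^ n) := by
  have hq : 1 < (Ideal.absNorm v.asIdeal : ℝ) := mod_cast HeightOneSpectrum.one_lt_absNorm v
  ext x
  rw [mem_ball_zero_iff, mem_closedBall_zero_iff]
  rcases eq_or_ne x 0 with rfl | hx
  · rw [norm_zero]
    exact iff_of_true (by positivity) (by positivity)
  · obtain ⟨m, hm⟩ := adic_norm_eq_zpow v hx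
    rw [hm, zpow_lt_zpow_iff_right₀ hq, zpow_le_zpow_iff_right₀ hq, Int.lt_add_one_iff]

theorem adic_exists_integer_norm_sub_lt_one {x : v.adicCompletion k} (hx : ‖x‖ ≤ 1) :
    ∃ r : 𝓞 k, ‖x - algebraMap k (v.adicCompletion k) r‖ < 1 := by
  obtain ⟨c, hc⟩ := (v.denseRange_algebraMap k).exists_dist_lt x one_pos
  have hc' : ‖algebraMap k (v.adicCompletion k) c‖ ≤ 1 := by
    rw [← dist_zero_right] at hx ⊢
    exact (dist_triangle_max _ x _).trans (max_le (dist_comm x _ ▸ hc.le) hx)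
  obtain ⟨r, hr⟩ := v.exists_valuation_sub_lt_of_integer (K := k)
    (v.valuedAdicCompletion_eq_valuation' (K := k) c ▸ Valued.toNormedField.norm_le_one_iff.1 hc') 1
  refine ⟨r, ?_⟩
  have hcr : dist (algebraMap k (v.adicCompletion k) r)
      (algebraMap k (v.adicCompletion k) c) < 1 := by
    rw [dist_eq_norm, ← map_sub]
    refine Valued.toNormedField.norm_lt_one_iff.2 ?_
    rwa [Units.val_one, ← v.valuedAdicCompletion_eq_valuation' (K := k)] at hr
  rw [← dist_eq_norm]
  exact (dist_triangle_max _ _ _).trans_lt (max_lt hc ((dist_comm _ _).trans_lt hcr))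

theorem adic_mem_ball_mul_iff {a : v.adicCompletion k} (ha : a ≠ 0) (r s : 𝓞 k) :
    a * algebraMap k (v.adicCompletion k) r ∈
        Metric.ball (a * algebraMap k (v.adicCompletion k) s) ‖a‖ ↔
      Ideal.Quotient.mk v.asIdeal r = Ideal.Quotient.mk v.asIdeal s := by
  rw [Ideal.Quotient.eq, ← FinitePlace.norm_lt_one_iff_mem k v, mem_ball_iff_norm, ← mul_sub,
    norm_mul, mul_lt_iff_lt_one_right (norm_pos_iff.2 ha), ← map_sub, ← map_sub]
  rfl

theorem adic_closedBall_eq_iUnion_ball {a : v.adicCompletion k} (ha : a ≠ 0) :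
    Metric.closedBall (0 : v.adicCompletion k) ‖a‖ = ⋃ s : 𝓞 k ⧸ v.asIdeal,
      Metric.ball (a * algebraMap k (v.adicCompletion k) (Quotient.out s : 𝓞 k)) ‖a‖ := by
  refine subset_antisymm (fun x hx => ?_) (Set.iUnion_subset fun s => ?_)
  · obtain ⟨r, hr⟩ : ∃ r : 𝓞 k, ‖a⁻¹ * x - algebraMap k (v.adicCompletion k) r‖ < 1 := by
      refine adic_exists_integer_norm_sub_lt_one v ?_
      rw [norm_mul, norm_inv, inv_mul_le_one₀ (norm_pos_iff.2 ha)]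
      exact mem_closedBall_zero_iff.1 hx
    have hxr : x ∈ Metric.ball (a * algebraMap k (v.adicCompletion k) r) ‖a‖ := by
      rw [← mul_lt_iff_lt_one_right (norm_pos_iff.2 ha), ← norm_mul, mul_sub,
        mul_inv_cancel_left₀ ha] at hr
      exact mem_ball_iff_norm.2 hr
    refine Set.mem_iUnion.2 ⟨Ideal.Quotient.mk v.asIdeal r, ?_⟩
    rwa [← IsUltrametricDist.ball_eq_of_mem
      ((adic_mem_ball_mul_iff v ha _ r).2 (Quotient.out_eq _))]
  · have hs : a * algebraMap k (v.adicCompletion k) (Quotient.out s : 𝓞 k) ∈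
        Metric.closedBall (0 : v.adicCompletion k) ‖a‖ := by
      rw [mem_closedBall_zero_iff, norm_mul]
      exact mul_le_of_le_one_right (norm_nonneg a) (FinitePlace.norm_le_one k v _)
    rw [IsUltrametricDist.closedBall_eq_of_mem hs]
    exact Metric.ball_subset_closedBall

instance adicVol_isAddHaarMeasure : (adicVol v).IsAddHaarMeasure :=
  inferInstanceAs (Measure.addHaarMeasure _).IsAddHaarMeasure

theorem adicVol_closedBall_norm {a : v.adicCompletion k} (ha : a ≠ 0) :
    adicVol v (Metric.closedBall 0 ‖a‖) =
      Ideal.absNorm v.asIdeal * adicVol v (Metric.ball 0 ‖a‖) := by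
  have : Finite (𝓞 k ⧸ v.asIdeal) := v.asIdeal.finiteQuotientOfFreeOfNeBot v.ne_bot
  have := Fintype.ofFinite (𝓞 k ⧸ v.asIdeal)
  have hdisj : Pairwise (Function.onFun Disjoint fun s : 𝓞 k ⧸ v.asIdeal =>
      Metric.ball (a * algebraMap k (v.adicCompletion k) (Quotient.out s : 𝓞 k)) ‖a‖) := by
    intro s t hst
    refine (IsUltrametricDist.ball_eq_or_disjoint _ _ _).resolve_left fun h => hst ?_
    have hmem := h ▸ Metric.mem_ball_self (norm_pos_iff.2 ha)
    simpa using (adic_mem_ball_mul_iff v ha _ _).1 hmem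
  have htranslate (c : v.adicCompletion k) :
      adicVol v (Metric.ball c ‖a‖) = adicVol v (Metric.ball 0 ‖a‖) := by
    rw [← measure_preimage_add (adicVol v) c, preimage_add_ball, sub_self]
  rw [adic_closedBall_eq_iUnion_ball v ha,
    measure_iUnion hdisj fun s => Metric.isOpen_ball.measurableSet, tsum_fintype]
  simp only [htranslate, Finset.sum_const, Finset.card_univ, nsmul_eq_mul, Ideal.absNorm_apply,
    Submodule.cardQuot_apply, Nat.card_eq_fintype_card]

theorem adicVol_closedBall_zpow (x : v.adicCompletion k) (n : ℤ) :
    adicVol v (Metric.closedBall x ((Ideal.absNorm v.asIdeal : ℝ) ^ n)) =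
      ((Ideal.absNorm v.asIdeal : ℝ≥0) ^ n : ℝ≥0) := by
  have hq : (Ideal.absNorm v.asIdeal : ℝ≥0) ≠ 0 := HeightOneSpectrum.absNorm_ne_zero v
  have hstep (m : ℤ) : adicVol v (Metric.closedBall 0 ((Ideal.absNorm v.asIdeal : ℝ) ^ (m + 1))) =
      (Ideal.absNorm v.asIdeal : ℝ≥0) *
        adicVol v (Metric.closedBall 0 ((Ideal.absNorm v.asIdeal : ℝ) ^ m)) := by
    obtain ⟨a, ha⟩ := adic_exists_norm_eq_zpow v (m + 1)
    have ha0 : a ≠ 0 := norm_ne_zero_iff.1 (ha ▸ zpow_ne_zero _ (mod_cast hq))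
    rw [← adic_ball_zpow_add_one v m, ← ha, adicVol_closedBall_norm v ha0, ENNReal.coe_natCast]
  rw [← measure_preimage_add (adicVol v) x, preimage_add_closedBall, sub_self]
  induction n using Int.induction_on with
  | zero =>
    rw [zpow_zero, zpow_zero]
    exact Measure.addHaarMeasure_self
  | succ m ih => rw [hstep, ih, zpow_add_one₀ hq, mul_comm, ENNReal.coe_mul]
  | pred m ih =>
    rw [← sub_add_cancel (-(m : ℤ)) 1, hstep, zpow_add_one₀ hq, mul_comm, ENNReal.coe_mul] at ih
    exact (ENNReal.mul_left_inj (ENNReal.coe_ne_zero.2 hq) ENNReal.coe_ne_top).1 ih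

theorem ahlforsRegular_adicVol : AhlforsRegular (adicVol v) 1 := by
  have hq : 1 < (Ideal.absNorm v.asIdeal : ℝ≥0) := HeightOneSpectrum.one_lt_absNorm_nnreal v
  have hq0 : (Ideal.absNorm v.asIdeal : ℝ≥0) ≠ 0 := HeightOneSpectrum.absNorm_ne_zero v
  refine ⟨Ideal.absNorm v.asIdeal, (Ideal.absNorm v.asIdeal : ℝ≥0)⁻¹, hq0, inv_ne_zero hq0,
    fun x r hr => ?_⟩
  obtain ⟨n, hnr, hrn⟩ := exists_mem_Ico_zpow (pos_iff_ne_zero.2 hr) hq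
  rw [pow_one, ← ENNReal.coe_mul, ← ENNReal.coe_mul]
  constructor
  · calc (((Ideal.absNorm v.asIdeal : ℝ≥0)⁻¹ * r : ℝ≥0) : ℝ≥0∞)
        ≤ ((Ideal.absNorm v.asIdeal : ℝ≥0) ^ n : ℝ≥0) := by
          rw [zpow_add_one₀ hq0, mul_comm] at hrn
          exact mod_cast (inv_mul_le_iff₀ (pos_iff_ne_zero.2 hq0)).2 hrn.le
      _ = adicVol v (Metric.closedBall x ((Ideal.absNorm v.asIdeal : ℝ) ^ n)) :=
          (adicVol_closedBall_zpow v x n).symm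
      _ ≤ adicVol v (Metric.closedBall x r) :=
          measure_mono (Metric.closedBall_subset_closedBall (mod_cast hnr))
  · calc adicVol v (Metric.closedBall x r)
        ≤ adicVol v (Metric.closedBall x ((Ideal.absNorm v.asIdeal : ℝ) ^ (n + 1))) :=
          measure_mono (Metric.closedBall_subset_closedBall (mod_cast hrn.le))
      _ = ((Ideal.absNorm v.asIdeal : ℝ≥0) ^ (n + 1) : ℝ≥0) := adicVol_closedBall_zpow v x _
      _ ≤ ((Ideal.absNorm v.asIdeal * r : ℝ≥0) : ℝ≥0∞) := by
          rw [zpow_add_one₀ hq0, mul_comm]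
          exact mod_cast mul_le_mul_right hnr _

end Nonarchimedean

end

end HomCap

theorem mainTheorem11 {k : Type*} [Field k] [NumberField k] :
    (∀ (w : InfinitePlace k) (E : Set (ℂ × ℂ)), E.Nonempty → Bornology.IsBounded E →
      HomCap.GaloisStable w.Completion E →
        Tendsto (HomCap.homDiameter (HomCap.archAbs w) E) atTop
          (𝓝 (HomCap.homTransfiniteDiameter (HomCap.archAbs w) E)) ∧
        Tendsto (HomCap.logVolume (HomCap.archVol w) (HomCap.archAbs w) E) atTop
          (𝓝 (-ENNReal.log (HomCap.homSectionalCapacity (HomCap.archVol w)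
            (HomCap.archAbs w) E))) ∧
        HomCap.homTransfiniteDiameter (HomCap.archAbs w) E ≠ ∞ ∧
        HomCap.homSectionalCapacity (HomCap.archVol w) (HomCap.archAbs w) E =
          HomCap.homTransfiniteDiameter (HomCap.archAbs w) E) ∧
    (∀ (v : HeightOneSpectrum (𝓞 k)) (E : Set (HomCap.AdicComplex v × HomCap.AdicComplex v)),
      E.Nonempty → Bornology.IsBounded E →
      HomCap.GaloisStable (v.adicCompletion k) E →
        Tendsto (HomCap.homDiameter (HomCap.adicAbs v) E) atTop
          (𝓝 (HomCap.homTransfiniteDiameter (HomCap.adicAbs v) E)) ∧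
        Tendsto (HomCap.logVolume (HomCap.adicVol v) (HomCap.adicAbs v) E) atTop
          (𝓝 (-ENNReal.log (HomCap.homSectionalCapacity (HomCap.adicVol v)
            (HomCap.adicAbs v) E))) ∧
        HomCap.homTransfiniteDiameter (HomCap.adicAbs v) E ≠ ∞ ∧
        HomCap.homSectionalCapacity (HomCap.adicVol v) (HomCap.adicAbs v) E =
          HomCap.homTransfiniteDiameter (HomCap.adicAbs v) E) :=
  ⟨fun w _ hne hbdd hE => (HomCap.GaloisStable.descends_arch w hE hbdd).homSectionalCapacity_eq
      hne hbdd InfinitePlace.mult_ne_zero (HomCap.ahlforsRegular_archVol w) fun _ => rfl,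
    fun v _ hne hbdd hE => (HomCap.GaloisStable.descends_adic v hE hbdd).homSectionalCapacity_eq
      hne hbdd one_ne_zero (HomCap.ahlforsRegular_adicVol v) fun _ => (pow_one _).symm⟩
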